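/- Let $I=[0,1]$. For integers $k,l\ge 1$ let $\mathcal P_{k,l}$ be the set of continuous functions $a:I^k\times I^l\to\mathbb R$, $(s_1,\dots,s_k;t_1,\dots,t_l)\mapsto a_{s_1\cdots s_k;t_1\cdots t_l}$, that vanish whenever $s_i=s_{i+1}$ or $t_j=t_{j+1}$ for some $i$ or $j$. Put $(\delta_1a)_{s_1\cdots s_{k+1};t}=\sum_{i=1}^{k+1}(-1)^{k-i}a_{s_1\cdots\hat s_i\cdots s_{k+1};t}$, define $\delta_2$ in the same way in the variables $t$, and let $\delta=\delta_1\delta_2$. The product $ab$ of two increments is taken by identifying, in each direction, the last variable of $a$ with the first variable of $b$; and $(a\circ b)_{s_1s_2;t_1t_2}=a_{s_1s_2;t_1}\,b_{s_1;t_1t_2}$ for $a\in\mathcal P_{2,1}$, $b\in\mathcal P_{1,2}$. For exponents $\mu,\nu>0$: * $\mathcal P_{2,2}^{\mu,\nu}$ is the set of $a\in\mathcal P_{2,2}$ with $|a_{s_1s_2;t_1t_2}|\le C|s_2-s_1|^{\mu}|t_2-t_1|^{\nu}$ for some $C$. * $\mathcal P_{1,1}^{\mu,\nu}$ is the set of $f\in\mathcal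 P_{1,1}$ with $|\delta_1f_{s_1s_2;t}|\le C|s_2-s_1|^{\mu}$, $|\delta_2f_{s;t_1t_2}|\le C|t_2-t_1|^{\nu}$ for some $C$, and $\delta f\in\mathcal P_{2,2}^{\mu,\nu}$. * $\mathcal P_{3,2}^{\mu,\nu}$ is the set of finite sums of elements of $\mathcal P_{3,2}$ each bounded by $C|s_2-s_1|^{\kappa}|s_3-s_2|^{\mu-\kappa}|t_2-t_1|^{\nu}$ for some $C$ and some $\kappa\in(0,\mu)$ (both depending on the summand). $\mathcal P_{2,3}^{\mu,\nu}$ is defined symmetrically: each summand is bounded by $C|s_2-s_1|^{\mu}|t_2-t_1|^{\kappa}|t_3-t_2|^{\nu-\kappa}$ with $\kappa\in(0,\nu)$. For $h\in\mathcal P_{3,2}^{\mu,\nu}\cap\delta_1(\mathcal P_{2,2})$ with $\mu>1$, $\nu>0$, let $\Lambda_1h$ be the element $R$ of $\mathcal P_{2,2}^{\mu,\nu}$ with $\delta_1R=h$. For $h\in\mathcal P_{2,3}^{\mu,\nu}\cap\delta_2(\mathcal P_{2,2})$ with $\mu>0$, $\nu>1$, let $\Lambda_2h$ be the element $R$ of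 $\mathcal P_{2,2}^{\mu,\nu}$ with $\delta_2R=h$. **Proposition.** Let $f\in\mathcal P_{1,1}^{\gamma_1,\gamma_2}$, $g\in\mathcal P_{1,1}^{\rho_1,\rho_2}$ and $h\in\mathcal P_{1,1}^{\beta_1,\beta_2}$ with positive exponents such that $\gamma_i+\rho_i>1$, $\beta_i+\gamma_i>1$ and $\beta_i+\rho_i>1$ for $i=1,2$. Then, for each of the three increments $$a^1=f\,\delta_1g\,\delta_2h,\qquad a^2=f\,\delta_2h\,\delta_1g,\qquad a^3=f\,(\delta_1g\circ\delta_2h)$$ of $\mathcal P_{2,2}$, the expression $[\mathrm{Id}-\Lambda_1\delta_1][\mathrm{Id}-\Lambda_2\delta_2](a^k)$ is well defined (that is, $\delta_2a^k$ lies in the domain of $\Lambda_2$, then $\delta_1[\mathrm{Id}-\Lambda_2\delta_2]a^k$ lies in the domain of $\Lambda_1$, and the values of $\Lambda_2$ and $\Lambda_1$ there exist and are unique). Setting $$\int_1\int_2 f\,d_1g\,d_2h=[\mathrm{Id}-\Lambda_1\delta_1][\mathrm{Id}-\Lambda_2\delta_2](f\,\delta_1g\,\delta_2h),$$ one also has $$\int_1\int_2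 f\,d_1g\,d_2h=[\mathrm{Id}-\Lambda_1\delta_1][\mathrm{Id}-\Lambda_2\delta_2](f\,\delta_2h\,\delta_1g)=[\mathrm{Id}-\Lambda_1\delta_1][\mathrm{Id}-\Lambda_2\delta_2](f\,(\delta_1g\circ\delta_2h)).$$ Moreover, for all $0\le s_1\le s_2\le1$ and $0\le t_1\le t_2\le 1$, $$\begin{aligned}\int_{s_1}^{s_2}\int_{t_1}^{t_2}f\,d_1g\,d_2h&=\lim\sum_{i,j}f_{\sigma_i;\tau_j}\,\delta_1g_{\sigma_i\sigma_{i+1};\tau_j}\,\delta_2h_{\sigma_{i+1};\tau_j\tau_{j+1}}\\&=\lim\sum_{i,j}f_{\sigma_i;\tau_j}\,\delta_1g_{\sigma_i\sigma_{i+1};\tau_j}\,\delta_2h_{\sigma_i;\tau_j\tau_{j+1}}\\&=\lim\sum_{i,j}f_{\sigma_i;\tau_j}\,\delta_2h_{\sigma_i;\tau_j\tau_{j+1}}\,\delta_1g_{\sigma_i\sigma_{i+1};\tau_{j+1}},\end{aligned}$$ where the left side is the value of $\int_1\int_2f\,d_1g\,d_2h$ at $(s_1,s_2;t_1,t_2)$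 and the limits are over all finite partitions $(\sigma_i)$ of $[s_1,s_2]$ and $(\tau_j)$ of $[t_1,t_2]$ as both meshes tend to $0$, independently of each other. -/

import Mathlib

namespace PlanarYoung

noncomputable section

/-- Real functions of `k` variables `s₁, …, s_k ∈ [0,1]` in direction 1 and `l` variables
`t₁, …, t_l ∈ [0,1]` in direction 2. Variables are numbered from `0` in Lean. -/
abbrev Inc (k l : ℕ) : Type := (Fin k → unitInterval) → (Fin l → unitInterval) → ℝ

/-- The space `𝒫_{k,l}` of planar increments: continuous functions that vanish as soon as two
consecutive variables in one direction coincide. -/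
def IsIncrement {k l : ℕ} (g : Inc k l) : Prop :=
  Continuous (fun p : (Fin k → unitInterval) × (Fin l → unitInterval) => g p.1 p.2) ∧
  (∀ s t, ∀ i j : Fin k, (i : ℕ) + 1 = j → s i = s j → g s t = 0) ∧
  (∀ s t, ∀ i j : Fin l, (i : ℕ) + 1 = j → t i = t j → g s t = 0)

/-- The partial coboundary in direction 1,
`(δ₁ g)_{s₁ ⋯ s_{k+1}; t} = ∑_{i=1}^{k+1} (-1)^{k-i} g_{s₁ ⋯ ŝ_i ⋯ s_{k+1}; t}`.
Here `i` is shifted by one, which gives the sign `(-1)^{k-(i+1)} = (-1)^{k+i+1}`. -/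
def delta₁ {k l : ℕ} (g : Inc k l) : Inc (k + 1) l := fun s t =>
  ∑ i : Fin (k + 1), (-1 : ℝ) ^ (k + (i : ℕ) + 1) * g (fun j => s (i.succAbove j)) t

/-- The partial coboundary in direction 2. -/
def delta₂ {k l : ℕ} (g : Inc k l) : Inc k (l + 1) := fun s t =>
  ∑ i : Fin (l + 1), (-1 : ℝ) ^ (l + (i : ℕ) + 1) * g s (fun j => t (i.succAbove j))

/-- The product of planar increments, gluing the last variables of `g` with the first variables
of `h` in both directions. -/
def mul {n₁ n₂ m₁ m₂ : ℕ} (g : Inc (n₁ + 1) (n₂ + 1)) (h : Inc (m₁ + 1) (m₂ + 1)) :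
    Inc (n₁ + m₁ + 1) (n₂ + m₂ + 1) := fun s t =>
  g (fun i => s (Fin.castLE (by omega) i)) (fun j => t (Fin.castLE (by omega) j)) *
    h (fun i => s (Fin.natAdd n₁ i)) (fun j => t (Fin.natAdd n₂ j))

/-- `(g ∘ h)_{s₁s₂; t₁t₂} = g_{s₁s₂; t₁} h_{s₁; t₁t₂}` for `g ∈ 𝒫_{2,1}`, `h ∈ 𝒫_{1,2}`. -/
def circ (g : Inc 2 1) (h : Inc 1 2) : Inc 2 2 := fun s t => g s ![t 0] * h ![s 0] t

/-- `|s₂ - s₁| ^ γ`. -/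
def weight₂ (γ : ℝ) (s : Fin 2 → unitInterval) : ℝ := |(s 1 : ℝ) - s 0| ^ γ

/-- `|s₂ - s₁| ^ κ |s₃ - s₂| ^ ρ`. -/
def weight₃ (κ ρ : ℝ) (s : Fin 3 → unitInterval) : ℝ :=
  |(s 1 : ℝ) - s 0| ^ κ * |(s 2 : ℝ) - s 1| ^ ρ

/-- The Hölder space `𝒫_{2,2}^{γ₁,γ₂}`. -/
def P22 (γ₁ γ₂ : ℝ) (g : Inc 2 2) : Prop :=
  IsIncrement g ∧ ∃ C : ℝ, ∀ s t, |g s t| ≤ C * weight₂ γ₁ s * weight₂ γ₂ t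

/-- The Hölder space `𝒫_{1,1}^{γ₁,γ₂}`: continuous functions on the square that are Hölder of
exponent `γ₁` in direction 1 (uniformly in direction 2), of exponent `γ₂` in direction 2 (uniformly
in direction 1), and whose rectangular increments `δ₁δ₂f` lie in `𝒫_{2,2}^{γ₁,γ₂}`. -/
def P11 (γ₁ γ₂ : ℝ) (f : Inc 1 1) : Prop :=
  IsIncrement f ∧
  (∃ C : ℝ, ∀ s t, |delta₁ f s t| ≤ C * weight₂ γ₁ s) ∧
  (∃ C : ℝ, ∀ s t, |delta₂ f s t| ≤ C * weight₂ γ₂ t) ∧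
  P22 γ₁ γ₂ (delta₁ (delta₂ f))

/-- The Hölder space `𝒫_{3,2}^{γ₁,γ₂}`: finite sums of increments, each bounded by a multiple of
`|s₂-s₁|^κ |s₃-s₂|^{γ₁-κ} |t₂-t₁|^{γ₂}` for some `κ ∈ (0,γ₁)` that may depend on the summand. -/
def P32 (γ₁ γ₂ : ℝ) (h : Inc 3 2) : Prop :=
  ∃ (n : ℕ) (κ : Fin n → ℝ) (H : Fin n → Inc 3 2),
    (∀ i, 0 < κ i ∧ κ i < γ₁ ∧ IsIncrement (H i) ∧
      ∃ C : ℝ, ∀ s t, |H i s t| ≤ C * weight₃ (κ i) (γ₁ - κ i) s * weight₂ γ₂ t) ∧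
    h = ∑ i, H i

/-- The Hölder space `𝒫_{2,3}^{γ₁,γ₂}`. -/
def P23 (γ₁ γ₂ : ℝ) (h : Inc 2 3) : Prop :=
  ∃ (n : ℕ) (κ : Fin n → ℝ) (H : Fin n → Inc 2 3),
    (∀ i, 0 < κ i ∧ κ i < γ₂ ∧ IsIncrement (H i) ∧
      ∃ C : ℝ, ∀ s t, |H i s t| ≤ C * weight₂ γ₁ s * weight₃ (κ i) (γ₂ - κ i) t) ∧
    h = ∑ i, H i

/-- `R` is a value of the sewing map in direction 1 at `h`: for some exponents `γ₁ > 1`, `γ₂ > 0`,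
`h` is a `δ₁`-boundary in `𝒫_{3,2}^{γ₁,γ₂}`, `R ∈ 𝒫_{2,2}^{γ₁,γ₂}` and `δ₁ R = h`. -/
def Sews₁ (h : Inc 3 2) (R : Inc 2 2) : Prop :=
  ∃ γ₁ γ₂ : ℝ, 1 < γ₁ ∧ 0 < γ₂ ∧ P32 γ₁ γ₂ h ∧ (∃ g : Inc 2 2, IsIncrement g ∧ delta₁ g = h) ∧
    P22 γ₁ γ₂ R ∧ delta₁ R = h

/-- `R` is a value of the sewing map in direction 2 at `h`: for some exponents `γ₁ > 0`, `γ₂ > 1`,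
`h` is a `δ₂`-boundary in `𝒫_{2,3}^{γ₁,γ₂}`, `R ∈ 𝒫_{2,2}^{γ₁,γ₂}` and `δ₂ R = h`. -/
def Sews₂ (h : Inc 2 3) (R : Inc 2 2) : Prop :=
  ∃ γ₁ γ₂ : ℝ, 0 < γ₁ ∧ 1 < γ₂ ∧ P23 γ₁ γ₂ h ∧ (∃ g : Inc 2 2, IsIncrement g ∧ delta₂ g = h) ∧
    P22 γ₁ γ₂ R ∧ delta₂ R = h

open Classical in
/-- The sewing map `Λ₁`; outside its domain it takes the value `0`. -/
def Lambda₁ (h : Inc 3 2) : Inc 2 2 := if H : ∃ R, Sews₁ h R then H.choose else 0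

open Classical in
/-- The sewing map `Λ₂`; outside its domain it takes the value `0`. -/
def Lambda₂ (h : Inc 2 3) : Inc 2 2 := if H : ∃ R, Sews₂ h R then H.choose else 0

/-- `[Id - Λ₂ δ₂] a`. -/
def integ₂ (a : Inc 2 2) : Inc 2 2 := a - Lambda₂ (delta₂ a)

/-- `[Id - Λ₁ δ₁] a`. -/
def integ₁ (a : Inc 2 2) : Inc 2 2 := a - Lambda₁ (delta₁ a)

/-- `[Id - Λ₁ δ₁] [Id - Λ₂ δ₂] a`. -/
def integ (a : Inc 2 2) : Inc 2 2 := integ₁ (integ₂ a)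

/-- The expression `[Id - Λ₁ δ₁] [Id - Λ₂ δ₂] a` is well defined: `a` is an increment, and each of
the two sewing maps is applied to an element of its domain and has exactly one possible value
there. -/
def IntegDefined (a : Inc 2 2) : Prop :=
  IsIncrement a ∧ (∃! R, Sews₂ (delta₂ a) R) ∧ (∃! R, Sews₁ (delta₁ (integ₂ a)) R)

/-- `f δ₁g δ₂h`. -/
def germ₁ (f g h : Inc 1 1) : Inc 2 2 := mul (mul f (delta₁ g)) (delta₂ h)

/-- `f δ₂h δ₁g`. -/
def germ₂ (f g h : Inc 1 1) : Inc 2 2 := mul (mul f (delta₂ h)) (delta₁ g)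

/-- `f (δ₁g ∘ δ₂h)`. -/
def germ₃ (f g h : Inc 1 1) : Inc 2 2 := mul f (circ (delta₁ g) (delta₂ h))

/-- The mixed Young integral `∫₁∫₂ f d₁g d₂h`. -/
def mixedYoung (f g h : Inc 1 1) : Inc 2 2 := integ (germ₁ f g h)

/-- Finite partitions `a = p₀ ≤ p₁ ≤ ⋯ ≤ p_n = b` of `[a,b] ⊆ [0,1]`. -/
structure Subdivision (a b : unitInterval) where
  n : ℕ
  pt : Fin (n + 1) → unitInterval
  mono : Monotone pt
  first : pt 0 = a
  last : pt (Fin.last n) = b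

/-- The mesh `max_i (p_{i+1} - p_i)` of a partition (`0` if the partition has no interval). -/
def Subdivision.mesh {a b : unitInterval} (p : Subdivision a b) : ℝ :=
  ⨆ i : Fin p.n, ((p.pt i.succ : ℝ) - p.pt i.castSucc)

/-- `lim ∑_{i,j} F s_i s_{i+1} t_j t_{j+1} = L` as the meshes of the partitions `(s_i)` of `[s₁,s₂]`
and `(t_j)` of `[t₁,t₂]` tend to `0`, jointly and independently of each other. -/
def RiemannLimit (s₁ s₂ t₁ t₂ : unitInterval)
    (F : unitInterval → unitInterval → unitInterval → unitInterval → ℝ) (L : ℝ) : Prop :=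
  ∀ ε > 0, ∃ η > 0, ∀ (p : Subdivision s₁ s₂) (q : Subdivision t₁ t₂),
    p.mesh < η → q.mesh < η →
    |(∑ i : Fin p.n, ∑ j : Fin q.n,
        F (p.pt i.castSucc) (p.pt i.succ) (q.pt j.castSucc) (q.pt j.succ)) - L| < ε

end

end PlanarYoung

open PlanarYoung

open Filter Topology Set

namespace PlanarYoung

/-! ### Sewing on the real line -/

/-! The engine is the one-parameter sewing lemma. If `A x y - A x u - A u y` is of order `ν > 1` in
the larger gap, exactly one additive function lies within `O(|y - x| ^ ν)` of `A`, namely the limit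
of its midpoint refinements (`midLim_add`, `sew_eq_of_additive`). Hence `Id - Λᵢ δᵢ` replaces a germ
by its additive version `sew₂` or `sew₁` (`eq_of_sews₂`, `eq_of_sews₁`), and an identity between
sewn objects follows once one side is additive and close to the germ of the other.

Each of the three germs is a Young germ `F G δ₂H` in direction 2, with `F = f`, `G = δ₁g` and `H =
h`, the variables of direction 1 being parameters. A Leibniz rule writes its `δ₂` as two terms of
orders `γ₂ + β₂` and `ρ₂ + β₂`, so `sew₂` applies. For the second step, uniqueness makes `sew₂`
commute with `δ₁`; and `δ₁` of the germ is again a sum of two Young germs, whose weights in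
direction 1 have total exponents `γ₁ + ρ₁` and `β₁ + ρ₁`. Sewing in direction 2 preserves these
weights, so `sew₁` applies. `IsGerm` packages these estimates.

The three integrals agree because moving the evaluation point of `δ₁g` in direction 2, or of `h` in
direction 1, changes the germ by a product of two increments in the same direction. This is of order
larger than one, which sewing does not see.

For the Riemann sums, additivity of `sew₂ a` collapses the sum in direction 2 and leaves a
one-dimensional sewing error in direction 1. The remainder `a - sew₂ a` is of order `|t' - t| ^ ν`
and almost additive in direction 1 with a constant of that same order. Its sums in direction 1 are
therefore bounded uniformly over partitions (`Sewable.abs_sum_le`), which makes the two meshes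
independent. -/

/-- Iterated midpoint refinements of a function of two variables. -/
noncomputable def midSum (A : ℝ → ℝ → ℝ) : ℕ → ℝ → ℝ → ℝ
  | 0 => A
  | n + 1 => fun x y => midSum A n x ((x + y) / 2) + midSum A n ((x + y) / 2) y

/-- The limit of the midpoint refinements. -/
noncomputable def midLim (A : ℝ → ℝ → ℝ) (x y : ℝ) : ℝ :=
  limUnder atTop (fun n => midSum A n x y)

/-- `A` is additive up to an error of order `ν`. -/
def AlmostAdditive (K ν : ℝ) (A : ℝ → ℝ → ℝ) : Prop :=
  ∀ x u y, |A x y - A x u - A u y| ≤ K * (max |u - x| |y - u|) ^ ν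

/-- The constant of the sewing lemma. -/
noncomputable def sewConst (ν : ℝ) : ℝ := 1 / (1 - 2 ^ (1 - ν))

theorem two_rpow_lt_one {ν : ℝ} (hν : 1 < ν) : (2 : ℝ) ^ (1 - ν) < 1 :=
  Real.rpow_lt_one_of_one_lt_of_neg (by norm_num) (by linarith)

theorem two_rpow_pos (ν : ℝ) : (0 : ℝ) < 2 ^ (1 - ν) := Real.rpow_pos_of_pos (by norm_num) _

theorem sewConst_pos {ν : ℝ} (hν : 1 < ν) : 0 < sewConst ν := by
  have := two_rpow_lt_one hν
  unfold sewConst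
  apply div_pos <;> linarith

theorem half_abs_rpow (ν d : ℝ) : 2 * |d / 2| ^ ν = 2 ^ (1 - ν) * |d| ^ ν := by
  rw [abs_div, Real.div_rpow (abs_nonneg _) (abs_nonneg _), Real.rpow_sub (by norm_num),
    Real.rpow_one, abs_of_pos (by norm_num : (0 : ℝ) < 2)]
  ring

/-- A refinement doubles the number of intervals and divides each error by `2 ^ ν`, whence the
geometric ratio `2 ^ (1 - ν)`. -/
theorem abs_midSum_succ_sub_le {K ν : ℝ} (hK : 0 ≤ K) (hν : 1 < ν) {A : ℝ → ℝ → ℝ}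
    (hA : AlmostAdditive K ν A) (n : ℕ) (x y : ℝ) :
    |midSum A n x y - midSum A (n + 1) x y| ≤ K * |y - x| ^ ν * (2 ^ (1 - ν)) ^ n := by
  induction n generalizing x y with
  | zero =>
    have h := hA x ((x + y) / 2) y
    simp only [midSum, pow_zero, mul_one]
    rw [← sub_sub]
    refine h.trans ?_
    gcongr
    rw [show (x + y) / 2 - x = (y - x) / 2 by ring, show y - (x + y) / 2 = (y - x) / 2 by ring,
      max_self, abs_div, abs_of_pos (by norm_num : (0 : ℝ) < 2)]
    linarith [abs_nonneg (y - x)]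
  | succ n ih =>
    have h1 := ih x ((x + y) / 2)
    have h2 := ih ((x + y) / 2) y
    rw [show (x + y) / 2 - x = (y - x) / 2 by ring] at h1
    rw [show y - (x + y) / 2 = (y - x) / 2 by ring] at h2
    have e : midSum A (n + 1) x y - midSum A (n + 1 + 1) x y =
        (midSum A n x ((x + y) / 2) - midSum A (n + 1) x ((x + y) / 2)) +
        (midSum A n ((x + y) / 2) y - midSum A (n + 1) ((x + y) / 2) y) := by
      simp only [midSum]; ring
    rw [e]
    refine (abs_add_le _ _).trans ((add_le_add h1 h2).trans (le_of_eq ?_))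
    have := half_abs_rpow ν (y - x)
    calc _ = K * (2 * |(y - x) / 2| ^ ν) * (2 ^ (1 - ν)) ^ n := by ring
      _ = _ := by rw [this]; ring

theorem tendsto_midSum {K ν : ℝ} (hK : 0 ≤ K) (hν : 1 < ν) {A : ℝ → ℝ → ℝ}
    (hA : AlmostAdditive K ν A) (x y : ℝ) :
    Tendsto (fun n => midSum A n x y) atTop (𝓝 (midLim A x y)) := by
  have : CauchySeq (fun n => midSum A n x y) :=
    cauchySeq_of_le_geometric _ _ (two_rpow_lt_one hν)
      (fun n => by rw [Real.dist_eq]; exact abs_midSum_succ_sub_le hK hν hA n x y)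
  exact this.tendsto_limUnder

theorem abs_midSum_sub_midLim_le {K ν : ℝ} (hK : 0 ≤ K) (hν : 1 < ν) {A : ℝ → ℝ → ℝ}
    (hA : AlmostAdditive K ν A) (n : ℕ) (x y : ℝ) :
    |midSum A n x y - midLim A x y| ≤
      sewConst ν * K * |y - x| ^ ν * (2 ^ (1 - ν)) ^ n := by
  have h := dist_le_of_le_geometric_of_tendsto _ _ (two_rpow_lt_one hν)
    (fun n => by rw [Real.dist_eq]; exact abs_midSum_succ_sub_le hK hν hA n x y)
    (tendsto_midSum hK hν hA x y) n
  rw [Real.dist_eq] at h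
  refine h.trans (le_of_eq ?_)
  unfold sewConst
  ring

theorem abs_sub_midLim_le {K ν : ℝ} (hK : 0 ≤ K) (hν : 1 < ν) {A : ℝ → ℝ → ℝ}
    (hA : AlmostAdditive K ν A) (x y : ℝ) :
    |A x y - midLim A x y| ≤ sewConst ν * K * |y - x| ^ ν := by
  simpa [midSum] using abs_midSum_sub_midLim_le hK hν hA 0 x y

theorem midLim_midpoint {K ν : ℝ} (hK : 0 ≤ K) (hν : 1 < ν) {A : ℝ → ℝ → ℝ}
    (hA : AlmostAdditive K ν A) (x y : ℝ) :
    midLim A x y = midLim A x ((x + y) / 2) + midLim A ((x + y) / 2) y := by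
  have h1 := (tendsto_add_atTop_iff_nat 1).2 (tendsto_midSum hK hν hA x y)
  have h2 := (tendsto_midSum hK hν hA x ((x + y) / 2)).add
    (tendsto_midSum hK hν hA ((x + y) / 2) y)
  exact tendsto_nhds_unique h1 h2

/-- A midpoint-additive function which is close to `A` is the limit of the midpoint refinements
of `A`. -/
theorem tendsto_midSum_of_midpoint {K ν : ℝ} (hν : 1 < ν) {A L : ℝ → ℝ → ℝ}
    (hL : ∀ x y, L x y = L x ((x + y) / 2) + L ((x + y) / 2) y)
    (hb : ∀ x y, |A x y - L x y| ≤ K * |y - x| ^ ν) (x y : ℝ) :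
    Tendsto (fun n => midSum A n x y) atTop (𝓝 (L x y)) := by
  have key : ∀ n : ℕ, ∀ x y,
      |midSum A n x y - L x y| ≤ K * |y - x| ^ ν * (2 ^ (1 - ν)) ^ n := by
    intro n
    induction n with
    | zero => simpa [midSum] using hb
    | succ n ih =>
      intro x y
      have h1 := ih x ((x + y) / 2)
      have h2 := ih ((x + y) / 2) y
      rw [show (x + y) / 2 - x = (y - x) / 2 by ring] at h1
      rw [show y - (x + y) / 2 = (y - x) / 2 by ring] at h2
      rw [hL x y, midSum, add_sub_add_comm]
      refine (abs_add_le _ _).trans ((add_le_add h1 h2).trans (le_of_eq ?_))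
      have := half_abs_rpow ν (y - x)
      calc _ = K * (2 * |(y - x) / 2| ^ ν) * (2 ^ (1 - ν)) ^ n := by ring
        _ = _ := by rw [this]; ring
  have hlim : Tendsto (fun n : ℕ => K * |y - x| ^ ν * ((2 : ℝ) ^ (1 - ν)) ^ n) atTop (𝓝 0) := by
    simpa using (tendsto_pow_atTop_nhds_zero_of_lt_one (two_rpow_pos ν).le
      (two_rpow_lt_one hν)).const_mul (K * |y - x| ^ ν)
  exact tendsto_iff_norm_sub_tendsto_zero.2
    (squeeze_zero (fun _ => norm_nonneg _) (fun n => key n x y) hlim)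

theorem midLim_eq_of_midpoint {K ν : ℝ} (hν : 1 < ν) {A L : ℝ → ℝ → ℝ}
    (hL : ∀ x y, L x y = L x ((x + y) / 2) + L ((x + y) / 2) y)
    (hb : ∀ x y, |A x y - L x y| ≤ K * |y - x| ^ ν) (x y : ℝ) : midLim A x y = L x y :=
  (tendsto_midSum_of_midpoint hν hL hb x y).limUnder_eq

/-- A midpoint-additive function which is small of order larger than one vanishes. -/
theorem eq_zero_of_midpoint {K ν : ℝ} (hν : 1 < ν) {D : ℝ → ℝ → ℝ}
    (hD : ∀ x y, D x y = D x ((x + y) / 2) + D ((x + y) / 2) y)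
    (hb : ∀ x y, |D x y| ≤ K * |y - x| ^ ν) (x y : ℝ) : D x y = 0 := by
  -- The midpoint refinements of `D` converge both to `D` and to `0`.
  have h1 := midLim_eq_of_midpoint hν hD (A := D) (K := 0) (by simp) x y
  have h2 := midLim_eq_of_midpoint hν (L := fun _ _ => 0) (by simp) (A := D) (by simpa using hb) x y
  exact h1.symm.trans h2

theorem continuous_midSum {P : Type*} [TopologicalSpace P] {A : P → ℝ → ℝ → ℝ}
    (hA : Continuous fun q : P × ℝ × ℝ => A q.1 q.2.1 q.2.2) (n : ℕ) :
    Continuous fun q : P × ℝ × ℝ => midSum (A q.1) n q.2.1 q.2.2 := by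
  induction n with
  | zero => exact hA
  | succ n ih =>
    have h1 := ih.comp (f := fun q : P × ℝ × ℝ => (q.1, q.2.1, (q.2.1 + q.2.2) / 2))
      (by fun_prop)
    have h2 := ih.comp (f := fun q : P × ℝ × ℝ => (q.1, (q.2.1 + q.2.2) / 2, q.2.2))
      (by fun_prop)
    exact h1.add h2

/-- The error of the refinements is controlled by `|y - x| ^ ν`, so convergence is locally uniform.
The parameter in `P` will hold the variables of the other direction. -/
theorem continuous_midLim {P : Type*} [TopologicalSpace P] {K ν : ℝ} (hK : 0 ≤ K) (hν : 1 < ν)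
    {A : P → ℝ → ℝ → ℝ} (hc : Continuous fun q : P × ℝ × ℝ => A q.1 q.2.1 q.2.2)
    (hA : ∀ p, AlmostAdditive K ν (A p)) :
    Continuous fun q : P × ℝ × ℝ => midLim (A q.1) q.2.1 q.2.2 := by
  have hS := sewConst_pos hν
  have hloc : TendstoLocallyUniformly
      (fun (n : ℕ) (q : P × ℝ × ℝ) => midSum (A q.1) n q.2.1 q.2.2)
      (fun q : P × ℝ × ℝ => midLim (A q.1) q.2.1 q.2.2) atTop := by
    rw [Metric.tendstoLocallyUniformly_iff]
    intro ε hε q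
    obtain ⟨M, hM⟩ : ∃ M, |q.2.2 - q.2.1| < M := ⟨_, lt_add_one _⟩
    have hM0 : 0 ≤ M := (abs_nonneg _).trans hM.le
    have ho : IsOpen {r : P × ℝ × ℝ | |r.2.2 - r.2.1| < M} :=
      isOpen_lt (by fun_prop) continuous_const
    refine ⟨_, ho.mem_nhds hM, ?_⟩
    have hlim : Tendsto (fun n : ℕ => sewConst ν * K * M ^ ν * ((2 : ℝ) ^ (1 - ν)) ^ n)
        atTop (𝓝 0) := by
      simpa using (tendsto_pow_atTop_nhds_zero_of_lt_one (two_rpow_pos ν).le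
        (two_rpow_lt_one hν)).const_mul (sewConst ν * K * M ^ ν)
    filter_upwards [hlim.eventually (gt_mem_nhds hε)] with n hn r hr
    rw [dist_comm, Real.dist_eq]
    refine (abs_midSum_sub_midLim_le hK hν (hA r.1) n r.2.1 r.2.2).trans_lt (lt_of_le_of_lt ?_ hn)
    have := (two_rpow_pos ν).le
    have hr' : |r.2.2 - r.2.1| ≤ M := le_of_lt hr
    gcongr
  exact hloc.continuous (Frequently.of_forall fun n => continuous_midSum hc n)

/-! ### From midpoint additivity to full additivity -/

/-- Sum over `k` intervals of equal length. -/
noncomputable def equiSum (L : ℝ → ℝ → ℝ) (k : ℕ) (x y : ℝ) : ℝ :=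
  ∑ i ∈ Finset.range k, L (x + i * ((y - x) / k)) (x + (i + 1 : ℕ) * ((y - x) / k))

theorem sum_range_two_mul (f : ℕ → ℝ) (k : ℕ) :
    ∑ i ∈ Finset.range (2 * k), f i = ∑ i ∈ Finset.range k, (f (2 * i) + f (2 * i + 1)) := by
  induction k with
  | zero => simp
  | succ k ih =>
    rw [show 2 * (k + 1) = 2 * k + 1 + 1 by ring, Finset.sum_range_succ, Finset.sum_range_succ,
      Finset.sum_range_succ, ih]
    ring

/-- Both sides are the sum of `L` over `2 * k` equal intervals: on the left each of the `k`
intervals is halved, on the right each half of `[x, y]` is cut into `k`. -/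
theorem equiSum_midpoint {L : ℝ → ℝ → ℝ}
    (hL : ∀ x y, L x y = L x ((x + y) / 2) + L ((x + y) / 2) y) {k : ℕ} (hk : k ≠ 0) (x y : ℝ) :
    equiSum L k x y = equiSum L k x ((x + y) / 2) + equiSum L k ((x + y) / 2) y := by
  have hk' : (k : ℝ) ≠ 0 := Nat.cast_ne_zero.2 hk
  set f : ℕ → ℝ := fun i =>
    L (x + i * ((y - x) / (2 * k))) (x + (i + 1 : ℕ) * ((y - x) / (2 * k))) with hf
  have h1 : equiSum L k x ((x + y) / 2) = ∑ i ∈ Finset.range k, f i := by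
    unfold equiSum
    refine Finset.sum_congr rfl fun i _ => ?_
    simp only [hf]
    congr 1 <;> field_simp <;> ring
  have h2 : equiSum L k ((x + y) / 2) y = ∑ i ∈ Finset.range k, f (k + i) := by
    unfold equiSum
    refine Finset.sum_congr rfl fun i _ => ?_
    simp only [hf]
    push_cast
    congr 1 <;> field_simp <;> ring
  have h3 : equiSum L k x y = ∑ i ∈ Finset.range (2 * k), f i := by
    rw [sum_range_two_mul]
    unfold equiSum
    refine Finset.sum_congr rfl fun i _ => ?_
    rw [hL]
    simp only [hf]
    push_cast
    congr 2 <;> field_simp <;> ring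
  rw [h1, h2, h3, two_mul, Finset.sum_range_add]

/-- Both sides are midpoint-additive and, with a constant depending on `k`, within order `ν` of `A`;
`eq_zero_of_midpoint` applies to the difference. -/
theorem midLim_eq_equiSum {K ν : ℝ} (hK : 0 ≤ K) (hν : 1 < ν) {A : ℝ → ℝ → ℝ}
    (hA : AlmostAdditive K ν A) (hA0 : ∀ x, A x x = 0) {k : ℕ} (hk : k ≠ 0) (x y : ℝ) :
    midLim A x y = equiSum (midLim A) k x y := by
  have hS := sewConst_pos hν
  have hk' : (0 : ℝ) < k := Nat.cast_pos.2 (Nat.pos_of_ne_zero hk)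
  have hk1 : (1 : ℝ) ≤ k := Nat.one_le_cast.2 (Nat.pos_of_ne_zero hk)
  refine sub_eq_zero.1 (eq_zero_of_midpoint
    (D := fun x y => midLim A x y - equiSum (midLim A) k x y)
    (K := sewConst ν * K + k * (K + sewConst ν * K)) hν ?_ ?_ x y)
  · intro x y
    rw [equiSum_midpoint (midLim_midpoint hK hν hA) hk, midLim_midpoint hK hν hA]
    ring
  · intro x y
    set p : ℕ → ℝ := fun i => x + i * ((y - x) / k) with hp
    -- Telescoping from the fixed base point `x` turns each term into one almost-additivity defect
    -- at `(x, p i, p (i + 1))` plus one sewing error, which explains the constant `k * (K +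
    -- sewConst ν * K)`.
    have htel : A x y = ∑ i ∈ Finset.range k, (A x (p (i + 1)) - A x (p i)) := by
      rw [Finset.sum_range_sub (fun i => A x (p i))]
      have h0 : p 0 = x := by simp [hp]
      have h1 : p k = y := by simp only [hp]; field_simp; ring
      rw [h0, h1, hA0, sub_zero]
    have e : midLim A x y - equiSum (midLim A) k x y = -(A x y - midLim A x y) +
        ∑ i ∈ Finset.range k, ((A x (p (i + 1)) - A x (p i) - A (p i) (p (i + 1))) +
          (A (p i) (p (i + 1)) - midLim A (p i) (p (i + 1)))) := by
      rw [Finset.sum_add_distrib, Finset.sum_sub_distrib, ← htel, Finset.sum_sub_distrib]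
      unfold equiSum
      simp only [hp]
      ring
    rw [e, add_mul]
    refine (abs_add_le _ _).trans (add_le_add ?_ ?_)
    · rw [abs_neg]; exact abs_sub_midLim_le hK hν hA x y
    · refine (Finset.abs_sum_le_sum_abs _ _).trans ?_
      have hterm : ∀ i ∈ Finset.range k,
          |(A x (p (i + 1)) - A x (p i) - A (p i) (p (i + 1))) +
          (A (p i) (p (i + 1)) - midLim A (p i) (p (i + 1)))| ≤
          (K + sewConst ν * K) * |y - x| ^ ν := by
        intro i hi
        have hik : (i : ℝ) ≤ k := Nat.cast_le.2 (Finset.mem_range.1 hi).le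
        have d1 : |p i - x| ≤ |y - x| := by
          have : p i - x = (i / k) * (y - x) := by simp only [hp]; field_simp; ring
          rw [this, abs_mul, abs_of_nonneg (by positivity)]
          exact mul_le_of_le_one_left (abs_nonneg _) ((div_le_one hk').2 hik)
        have d2 : |p (i + 1) - p i| ≤ |y - x| := by
          have : p (i + 1) - p i = (1 / k) * (y - x) := by
            simp only [hp]; push_cast; field_simp; ring
          rw [this, abs_mul, abs_of_nonneg (by positivity)]
          exact mul_le_of_le_one_left (abs_nonneg _) ((div_le_one hk').2 hk1)
        refine (abs_add_le _ _).trans ?_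
        rw [add_mul]
        refine add_le_add ((hA x (p i) (p (i + 1))).trans ?_)
          ((abs_sub_midLim_le hK hν hA _ _).trans ?_)
        · gcongr
          exact max_le d1 d2
        · gcongr
      refine (Finset.sum_le_sum hterm).trans (le_of_eq ?_)
      rw [Finset.sum_const, Finset.card_range, nsmul_eq_mul]
      ring

theorem midLim_self {K ν : ℝ} (hK : 0 ≤ K) (hν : 1 < ν) {A : ℝ → ℝ → ℝ}
    (hA : AlmostAdditive K ν A) (hA0 : ∀ x, A x x = 0) (x : ℝ) : midLim A x x = 0 := by
  have h := abs_sub_midLim_le hK hν hA x x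
  rw [hA0, sub_self, abs_zero, Real.zero_rpow (by linarith), mul_zero, zero_sub, abs_neg] at h
  exact abs_nonpos_iff.1 h

/-- Almost additivity at the degenerate triple `(x, y, x)` shows that the symmetric sum, itself
midpoint-additive, is of order `ν`. -/
theorem midLim_add_swap {K ν : ℝ} (hK : 0 ≤ K) (hν : 1 < ν) {A : ℝ → ℝ → ℝ}
    (hA : AlmostAdditive K ν A) (hA0 : ∀ x, A x x = 0) (x y : ℝ) :
    midLim A x y + midLim A y x = 0 := by
  refine eq_zero_of_midpoint (D := fun x y => midLim A x y + midLim A y x)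
    (K := K + 2 * (sewConst ν * K)) hν ?_ ?_ x y
  · intro x y
    rw [midLim_midpoint hK hν hA x y, midLim_midpoint hK hν hA y x, add_comm y x]
    ring
  · intro x y
    have h1 := abs_sub_midLim_le hK hν hA x y
    have h2 := abs_sub_midLim_le hK hν hA y x
    have h3 := hA x y x
    rw [abs_sub_comm x y] at h2
    rw [hA0, abs_sub_comm x y, max_self] at h3
    rw [abs_le] at *
    constructor <;> linarith [h1.1, h1.2, h2.1, h2.2, h3.1, h3.2]

/-- All three values are sums over one grid of step `d`, so additivity is concatenation of sums. -/
theorem midLim_rational {K ν : ℝ} (hK : 0 ≤ K) (hν : 1 < ν) {A : ℝ → ℝ → ℝ}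
    (hA : AlmostAdditive K ν A) (hA0 : ∀ x, A x x = 0) {j k : ℕ} (hk : k ≠ 0) (hj : j ≠ 0)
    (x d : ℝ) :
    midLim A x (x + (j + k : ℕ) * d) =
      midLim A x (x + j * d) + midLim A (x + j * d) (x + (j + k : ℕ) * d) := by
  have hk' : (k : ℝ) ≠ 0 := Nat.cast_ne_zero.2 hk
  have hj' : (j : ℝ) ≠ 0 := Nat.cast_ne_zero.2 hj
  have hjk : j + k ≠ 0 := by omega
  have hjk' : (j : ℝ) + k ≠ 0 := by exact_mod_cast hjk
  rw [midLim_eq_equiSum hK hν hA hA0 hjk, midLim_eq_equiSum hK hν hA hA0 hj,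
    midLim_eq_equiSum hK hν hA hA0 hk (x + j * d)]
  unfold equiSum
  rw [Finset.sum_range_add]
  congr 1
  · refine Finset.sum_congr rfl fun i _ => ?_
    push_cast
    congr 1 <;> field_simp <;> ring
  · refine Finset.sum_congr rfl fun i _ => ?_
    push_cast
    congr 1 <;> field_simp <;> ring

/-- The sewing lemma: the limit of the midpoint refinements is additive. -/
theorem midLim_add {K ν : ℝ} (hK : 0 ≤ K) (hν : 1 < ν) {A : ℝ → ℝ → ℝ}
    (hc : Continuous fun q : ℝ × ℝ => A q.1 q.2)
    (hA : AlmostAdditive K ν A) (hA0 : ∀ x, A x x = 0) (x u y : ℝ) :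
    midLim A x u + midLim A u y = midLim A x y := by
  have hcL : Continuous fun q : ℝ × ℝ => midLim A q.1 q.2 := by
    have := continuous_midLim (P := Unit) (A := fun _ => A) hK hν
      (by exact hc.comp continuous_snd) (fun _ => hA)
    exact this.comp (f := fun q : ℝ × ℝ => ((), q)) (by fun_prop)
  -- the case of `u` strictly between `x` and `y`
  have hbetween : ∀ x y θ : ℝ, θ ∈ Ioo (0 : ℝ) 1 →
      midLim A x (x + θ * (y - x)) + midLim A (x + θ * (y - x)) y = midLim A x y := by
    intro x y θ hθ
    have hclosed : IsClosed {θ : ℝ |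
        midLim A x (x + θ * (y - x)) + midLim A (x + θ * (y - x)) y = midLim A x y} := by
      refine isClosed_eq (Continuous.add ?_ ?_) continuous_const
      · exact hcL.comp (f := fun θ : ℝ => (x, x + θ * (y - x))) (by fun_prop)
      · exact hcL.comp (f := fun θ : ℝ => (x + θ * (y - x), y)) (by fun_prop)
    -- A rational `θ = j / q.den` is a node of the grid of step `(y - x) / q.den`; density and
    -- continuity then reach every `θ`.
    have hsub : Ioo (0 : ℝ) 1 ∩ range ((↑) : ℚ → ℝ) ⊆ {θ : ℝ |
        midLim A x (x + θ * (y - x)) + midLim A (x + θ * (y - x)) y = midLim A x y} := by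
      rintro _ ⟨⟨h0, h1⟩, q, rfl⟩
      have hq0 : 0 < q := by exact_mod_cast h0
      have hq1 : q < 1 := by exact_mod_cast h1
      obtain ⟨j, hj⟩ : ∃ j : ℕ, q.num = j := ⟨q.num.toNat, by
        rw [Int.toNat_of_nonneg (Rat.num_nonneg.2 hq0.le)]⟩
      have hj0 : j ≠ 0 := by
        rintro rfl
        simp at hj
        exact hq0.ne' hj
      have hqe : (q : ℝ) = j / q.den := by
        rw [Rat.cast_def, hj]; simp
      have hd : (0 : ℝ) < q.den := Nat.cast_pos.2 q.den_pos
      have hlt : j < q.den := by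
        rw [hqe, div_lt_one hd] at h1
        exact_mod_cast h1
      obtain ⟨k, hk⟩ := Nat.exists_eq_add_of_lt hlt
      have h := midLim_rational hK hν hA hA0 (j := j) (k := k + 1) (by omega) hj0 x
        ((y - x) / q.den)
      rw [show j + (k + 1) = q.den by omega,
        show x + (q.den : ℝ) * ((y - x) / q.den) = y by field_simp; ring,
        show x + (j : ℝ) * ((y - x) / q.den) = x + (q : ℝ) * (y - x) by rw [hqe]; ring] at h
      exact h.symm
    have hdense : Ioo (0 : ℝ) 1 ⊆ closure (Ioo (0 : ℝ) 1 ∩ range ((↑) : ℚ → ℝ)) := by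
      exact (Rat.denseRange_cast (𝕜 := ℝ)).open_subset_closure_inter isOpen_Ioo
    exact closure_minimal hsub hclosed (hdense hθ)
  have hord : ∀ x u y : ℝ, x ≤ u → u ≤ y → midLim A x u + midLim A u y = midLim A x y := by
    intro x u y hxu huy
    rcases hxu.eq_or_lt with rfl | hxu
    · rw [midLim_self hK hν hA hA0, zero_add]
    rcases huy.eq_or_lt with rfl | huy
    · rw [midLim_self hK hν hA hA0, add_zero]
    have hxy : 0 < y - x := by linarith
    have h := hbetween x y ((u - x) / (y - x)) ⟨by apply div_pos <;> linarith,
      (div_lt_one hxy).2 (by linarith)⟩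
    rwa [show x + (u - x) / (y - x) * (y - x) = u by field_simp; ring] at h
  -- Antisymmetry reduces every ordering of `x`, `u`, `y` to the increasing one.
  have hs := midLim_add_swap hK hν hA hA0
  rcases le_total x u with h1 | h1 <;> rcases le_total u y with h2 | h2 <;>
    rcases le_total x y with h3 | h3
  · exact hord x u y h1 h2
  · exact hord x u y h1 h2
  · linarith [hord x y u h3 h2, hs u y]
  · linarith [hord y x u h3 h1, hs u y, hs x y]
  · linarith [hord u x y h1 h3, hs u x]
  · linarith [hord u y x h2 h3, hs u x, hs x y]
  · linarith [hord y u x h2 h1, hs u x, hs x y, hs u y]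
  · linarith [hord y u x h2 h1, hs u x, hs x y, hs u y]

/-! ### Sewing on the unit interval -/

/-- A continuous function of two variables in `[0,1]` to which the sewing lemma applies. -/
structure Sewable (K ν : ℝ) (A : unitInterval → unitInterval → ℝ) : Prop where
  nonneg : 0 ≤ K
  one_lt : 1 < ν
  cont : Continuous fun q : unitInterval × unitInterval => A q.1 q.2
  diag : ∀ x, A x x = 0
  bound : ∀ x u y, |A x y - A x u - A u y| ≤ K * (max |(u : ℝ) - x| |(y : ℝ) - u|) ^ ν

/-- Extension of a function of two variables in `[0,1]` to the real line. -/
noncomputable def extendReal (A : unitInterval → unitInterval → ℝ) (x y : ℝ) : ℝ :=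
  A (projIcc 0 1 zero_le_one x) (projIcc 0 1 zero_le_one y)

/-- The additive function close to `A`. -/
noncomputable def sew (A : unitInterval → unitInterval → ℝ) (x y : unitInterval) : ℝ :=
  midLim (extendReal A) x y

theorem extendReal_coe (A : unitInterval → unitInterval → ℝ) (x y : unitInterval) :
    extendReal A x y = A x y := by
  simp only [extendReal, projIcc_val]

theorem abs_projIcc_sub_le (x y : ℝ) :
    |((projIcc (0 : ℝ) 1 zero_le_one y : unitInterval) : ℝ) -
      (projIcc (0 : ℝ) 1 zero_le_one x : unitInterval)| ≤ |y - x| := by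
  have := LipschitzWith.dist_le_mul (LipschitzWith.projIcc (zero_le_one' ℝ)) y x
  rwa [NNReal.coe_one, one_mul, Real.dist_eq, Subtype.dist_eq, Real.dist_eq] at this

theorem Sewable.almostAdditive {K ν : ℝ} {A : unitInterval → unitInterval → ℝ}
    (h : Sewable K ν A) : AlmostAdditive K ν (extendReal A) := by
  intro x u y
  refine (h.bound _ _ _).trans ?_
  have := h.nonneg
  have := h.one_lt
  gcongr ?_ * ?_ ^ _
  exact max_le_max (abs_projIcc_sub_le _ _) (abs_projIcc_sub_le _ _)

theorem Sewable.sew_add {K ν : ℝ} {A : unitInterval → unitInterval → ℝ} (h : Sewable K ν A)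
    (x u y : unitInterval) : sew A x u + sew A u y = sew A x y := by
  refine midLim_add h.nonneg h.one_lt ?_ h.almostAdditive (fun x => h.diag _) _ _ _
  exact h.cont.comp (f := fun q : ℝ × ℝ =>
    ((projIcc 0 1 zero_le_one q.1 : unitInterval), (projIcc 0 1 zero_le_one q.2 : unitInterval)))
    ((continuous_projIcc.comp continuous_fst).prodMk (continuous_projIcc.comp continuous_snd))

theorem Sewable.abs_sub_sew_le {K ν : ℝ} {A : unitInterval → unitInterval → ℝ}
    (h : Sewable K ν A) (x y : unitInterval) :
    |A x y - sew A x y| ≤ sewConst ν * K * |(y : ℝ) - x| ^ ν := by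
  have := abs_sub_midLim_le h.nonneg h.one_lt h.almostAdditive x y
  rwa [extendReal_coe] at this

/-- Uniqueness in the sewing lemma. No almost-additivity of `A` is assumed: closeness to an additive
function suffices. -/
theorem sew_eq_of_additive {K ν : ℝ} (hν : 1 < ν) {A L : unitInterval → unitInterval → ℝ}
    (hL : ∀ x u y, L x u + L u y = L x y)
    (hb : ∀ x y, |A x y - L x y| ≤ K * |(y : ℝ) - x| ^ ν) (x y : unitInterval) :
    sew A x y = L x y := by
  have hK : 0 ≤ K := by
    have := (abs_nonneg _).trans (hb 0 1)
    simpa using this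
  rw [← extendReal_coe L]
  refine midLim_eq_of_midpoint (K := K) (L := extendReal L) hν (fun x y => (hL _ _ _).symm)
    (fun x y => ?_) _ _
  refine (hb _ _).trans ?_
  gcongr ?_ * ?_ ^ _
  exact abs_projIcc_sub_le _ _

theorem continuous_sew {P : Type*} [TopologicalSpace P] {K ν : ℝ}
    {A : P → unitInterval → unitInterval → ℝ}
    (hc : Continuous fun q : P × unitInterval × unitInterval => A q.1 q.2.1 q.2.2)
    (hA : ∀ p, Sewable K ν (A p)) :
    Continuous fun q : P × unitInterval × unitInterval => sew (A q.1) q.2.1 q.2.2 := by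
  -- The facts `0 ≤ K` and `1 < ν` are read off from some `Sewable` instance, hence a point of `P`
  -- is needed.
  rcases isEmpty_or_nonempty P with hP | ⟨⟨p⟩⟩
  · exact continuous_of_const fun q => (hP.false q.1).elim
  have h := continuous_midLim (A := fun p => extendReal (A p)) (hA p).nonneg (hA p).one_lt ?_
    (fun p => (hA p).almostAdditive)
  · exact h.comp (f := fun q : P × unitInterval × unitInterval =>
      (q.1, (q.2.1 : ℝ), (q.2.2 : ℝ))) (by fun_prop)
  · exact hc.comp (f := fun q : P × ℝ × ℝ =>
      (q.1, (projIcc 0 1 zero_le_one q.2.1 : unitInterval),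
        (projIcc 0 1 zero_le_one q.2.2 : unitInterval)))
      (continuous_fst.prodMk ((continuous_projIcc.comp (by fun_prop)).prodMk
        (continuous_projIcc.comp (by fun_prop))))

/-! ### Coboundaries -/

theorem delta₁_apply_one {l : ℕ} (f : Inc 1 l) (s : Fin 2 → unitInterval)
    (t : Fin l → unitInterval) : delta₁ f s t = f ![s 1] t - f ![s 0] t := by
  have h0 : (fun j : Fin 1 => s (Fin.succAbove 0 j)) = ![s 1] := by ext j; fin_cases j; rfl
  have h1 : (fun j : Fin 1 => s (Fin.succAbove 1 j)) = ![s 0] := by ext j; fin_cases j; rfl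
  refine (Fin.sum_univ_two fun i : Fin 2 =>
    (-1 : ℝ) ^ (1 + (i : ℕ) + 1) * f (fun j => s (i.succAbove j)) t).trans ?_
  rw [h0, h1]
  norm_num
  ring

theorem delta₂_apply_one {k : ℕ} (f : Inc k 1) (s : Fin k → unitInterval)
    (t : Fin 2 → unitInterval) : delta₂ f s t = f s ![t 1] - f s ![t 0] := by
  have h0 : (fun j : Fin 1 => t (Fin.succAbove 0 j)) = ![t 1] := by ext j; fin_cases j; rfl
  have h1 : (fun j : Fin 1 => t (Fin.succAbove 1 j)) = ![t 0] := by ext j; fin_cases j; rfl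
  refine (Fin.sum_univ_two fun i : Fin 2 =>
    (-1 : ℝ) ^ (1 + (i : ℕ) + 1) * f s (fun j => t (i.succAbove j))).trans ?_
  rw [h0, h1]
  norm_num
  ring

theorem delta₁_apply_two {l : ℕ} (a : Inc 2 l) (s : Fin 3 → unitInterval)
    (t : Fin l → unitInterval) :
    delta₁ a s t = a ![s 0, s 2] t - a ![s 0, s 1] t - a ![s 1, s 2] t := by
  have h0 : (fun j : Fin 2 => s (Fin.succAbove 0 j)) = ![s 1, s 2] := by
    ext j; fin_cases j <;> rfl
  have h1 : (fun j : Fin 2 => s (Fin.succAbove 1 j)) = ![s 0, s 2] := by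
    ext j; fin_cases j <;> rfl
  have h2 : (fun j : Fin 2 => s (Fin.succAbove 2 j)) = ![s 0, s 1] := by
    ext j; fin_cases j <;> rfl
  refine (Fin.sum_univ_three fun i : Fin 3 =>
    (-1 : ℝ) ^ (2 + (i : ℕ) + 1) * a (fun j => s (i.succAbove j)) t).trans ?_
  rw [h0, h1, h2]
  norm_num
  ring

theorem delta₂_apply_two {k : ℕ} (a : Inc k 2) (s : Fin k → unitInterval)
    (t : Fin 3 → unitInterval) :
    delta₂ a s t = a s ![t 0, t 2] - a s ![t 0, t 1] - a s ![t 1, t 2] := by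
  have h0 : (fun j : Fin 2 => t (Fin.succAbove 0 j)) = ![t 1, t 2] := by
    ext j; fin_cases j <;> rfl
  have h1 : (fun j : Fin 2 => t (Fin.succAbove 1 j)) = ![t 0, t 2] := by
    ext j; fin_cases j <;> rfl
  have h2 : (fun j : Fin 2 => t (Fin.succAbove 2 j)) = ![t 0, t 1] := by
    ext j; fin_cases j <;> rfl
  refine (Fin.sum_univ_three fun i : Fin 3 =>
    (-1 : ℝ) ^ (2 + (i : ℕ) + 1) * a s (fun j => t (i.succAbove j))).trans ?_
  rw [h0, h1, h2]
  norm_num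
  ring

theorem vec_two (s : Fin 2 → unitInterval) : ![s 0, s 1] = s := by
  ext j; fin_cases j <;> rfl

theorem vec_one (s : Fin 1 → unitInterval) : ![s 0] = s := by
  ext j; fin_cases j; rfl

/-! ### Weights and gaps -/

theorem weight₂_nonneg (γ : ℝ) (s : Fin 2 → unitInterval) : 0 ≤ weight₂ γ s :=
  Real.rpow_nonneg (abs_nonneg _) _

theorem weight₃_nonneg (κ ρ : ℝ) (s : Fin 3 → unitInterval) : 0 ≤ weight₃ κ ρ s :=
  mul_nonneg (Real.rpow_nonneg (abs_nonneg _) _) (Real.rpow_nonneg (abs_nonneg _) _)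

theorem abs_sub_le_one (x y : unitInterval) : |(y : ℝ) - x| ≤ 1 := by
  rw [abs_le]; constructor <;> linarith [x.2.1, x.2.2, y.2.1, y.2.2]

theorem weight₂_le_one {γ : ℝ} (hγ : 0 ≤ γ) (s : Fin 2 → unitInterval) : weight₂ γ s ≤ 1 :=
  Real.rpow_le_one (abs_nonneg _) (abs_sub_le_one _ _) hγ

theorem weight₃_le_one {κ ρ : ℝ} (hκ : 0 ≤ κ) (hρ : 0 ≤ ρ) (s : Fin 3 → unitInterval) :
    weight₃ κ ρ s ≤ 1 :=
  mul_le_one₀ (Real.rpow_le_one (abs_nonneg _) (abs_sub_le_one _ _) hκ)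
    (Real.rpow_nonneg (abs_nonneg _) _) (Real.rpow_le_one (abs_nonneg _) (abs_sub_le_one _ _) hρ)

theorem weight₂_anti {γ γ' : ℝ} (hγ : 0 < γ) (h : γ ≤ γ') (s : Fin 2 → unitInterval) :
    weight₂ γ' s ≤ weight₂ γ s :=
  Real.rpow_le_rpow_of_exponent_ge_of_imp (abs_nonneg _) (abs_sub_le_one _ _) h
    (fun _ h0 => absurd h0 (hγ.trans_le h).ne')

theorem weight₂_eq_zero {γ : ℝ} (hγ : 0 < γ) {s : Fin 2 → unitInterval} (h : s 0 = s 1) :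
    weight₂ γ s = 0 := by
  simp [weight₂, h, Real.zero_rpow hγ.ne']

theorem weight₃_eq_zero_left {κ ρ : ℝ} (hγ : 0 < κ) {s : Fin 3 → unitInterval} (h : s 0 = s 1) :
    weight₃ κ ρ s = 0 := by
  simp [weight₃, h, Real.zero_rpow hγ.ne']

theorem weight₃_eq_zero_right {κ ρ : ℝ} (hγ : 0 < ρ) {s : Fin 3 → unitInterval} (h : s 1 = s 2) :
    weight₃ κ ρ s = 0 := by
  simp [weight₃, h, Real.zero_rpow hγ.ne']

/-- The larger one of the two gaps of a triple. -/
noncomputable def gap (s : Fin 3 → unitInterval) : ℝ := max |(s 1 : ℝ) - s 0| |(s 2 : ℝ) - s 1|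

theorem gap_nonneg (s : Fin 3 → unitInterval) : 0 ≤ gap s := (abs_nonneg _).trans (le_max_left _ _)

theorem gap_le_one (s : Fin 3 → unitInterval) : gap s ≤ 1 :=
  max_le (abs_sub_le_one _ _) (abs_sub_le_one _ _)

theorem weight₃_le_gap {κ ρ ν : ℝ} (hκ : 0 < κ) (hρ : 0 < ρ) (h : ν ≤ κ + ρ)
    (s : Fin 3 → unitInterval) : weight₃ κ ρ s ≤ gap s ^ ν := by
  rcases (gap_nonneg s).eq_or_lt with h0 | h0
  · have : |(s 1 : ℝ) - s 0| = 0 := le_antisymm (h0 ▸ le_max_left _ _) (abs_nonneg _)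
    rw [weight₃, this, Real.zero_rpow hκ.ne', zero_mul]
    exact Real.rpow_nonneg (gap_nonneg s) _
  calc weight₃ κ ρ s ≤ gap s ^ κ * gap s ^ ρ := by
        unfold weight₃
        gcongr
        · exact le_max_left _ _
        · exact le_max_right _ _
    _ = gap s ^ (κ + ρ) := (Real.rpow_add h0 _ _).symm
    _ ≤ gap s ^ ν := Real.rpow_le_rpow_of_exponent_ge h0 (gap_le_one s) h

theorem delta₁_delta₂ {k l : ℕ} (a : Inc k l) : delta₁ (delta₂ a) = delta₂ (delta₁ a) := by
  ext s t
  simp only [delta₁, delta₂, Finset.mul_sum]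
  rw [Finset.sum_comm]
  exact Finset.sum_congr rfl fun _ _ => Finset.sum_congr rfl fun _ _ => by ring

theorem delta₁_sub {k l : ℕ} (a b : Inc k l) : delta₁ (a - b) = delta₁ a - delta₁ b := by
  ext s t
  simp only [delta₁, Pi.sub_apply, mul_sub, Finset.sum_sub_distrib]

theorem delta₂_sub {k l : ℕ} (a b : Inc k l) : delta₂ (a - b) = delta₂ a - delta₂ b := by
  ext s t
  simp only [delta₂, Pi.sub_apply, mul_sub, Finset.sum_sub_distrib]

theorem delta₂_add {k l : ℕ} (a b : Inc k l) : delta₂ (a + b) = delta₂ a + delta₂ b := by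
  ext s t
  simp only [delta₂, Pi.add_apply, mul_add, Finset.sum_add_distrib]

theorem delta₁_zero {k l : ℕ} : delta₁ (0 : Inc k l) = 0 := by
  ext s t; simp [delta₁]

/-- Joint continuity of a function of several variables in both directions. -/
def ContInc {k l : ℕ} (a : Inc k l) : Prop :=
  Continuous fun p : (Fin k → unitInterval) × (Fin l → unitInterval) => a p.1 p.2

theorem ContInc.comp {k l : ℕ} {a : Inc k l} (h : ContInc a) {X : Type*} [TopologicalSpace X]
    {φ : X → Fin k → unitInterval} {ψ : X → Fin l → unitInterval} (hφ : Continuous φ)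
    (hψ : Continuous ψ) : Continuous fun x => a (φ x) (ψ x) :=
  Continuous.comp h (hφ.prodMk hψ)

theorem ContInc.add {k l : ℕ} {a b : Inc k l} (ha : ContInc a) (hb : ContInc b) :
    ContInc (a + b) := Continuous.add ha hb

theorem ContInc.sub {k l : ℕ} {a b : Inc k l} (ha : ContInc a) (hb : ContInc b) :
    ContInc (a - b) := Continuous.sub ha hb

theorem ContInc.delta₁ {k l : ℕ} {a : Inc k l} (ha : ContInc a) : ContInc (delta₁ a) := by
  refine continuous_finsetSum _ fun i _ => continuous_const.mul (ha.comp ?_ continuous_snd)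
  exact continuous_pi fun j => (continuous_apply _).comp continuous_fst

theorem ContInc.delta₂ {k l : ℕ} {a : Inc k l} (ha : ContInc a) : ContInc (delta₂ a) := by
  refine continuous_finsetSum _ fun i _ => continuous_const.mul (ha.comp continuous_fst ?_)
  exact continuous_pi fun j => (continuous_apply _).comp continuous_snd

/-- Positive exponents make the weights vanish on the diagonals, so the bound alone yields the
vanishing conditions. -/
theorem isIncrement_of_bound₂₂ {a : Inc 2 2} (hc : ContInc a) {C α β : ℝ} (hα : 0 < α)
    (hβ : 0 < β) (hb : ∀ s t, |a s t| ≤ C * weight₂ α s * weight₂ β t) : IsIncrement a := by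
  refine ⟨hc, fun s t i j hij h => ?_, fun s t i j hij h => ?_⟩
  · have hs : s 0 = s 1 := by fin_cases i <;> fin_cases j <;> simp_all
    have := hb s t
    rw [weight₂_eq_zero hα hs] at this
    simpa using this
  · have hs : t 0 = t 1 := by fin_cases i <;> fin_cases j <;> simp_all
    have := hb s t
    rw [weight₂_eq_zero hβ hs] at this
    simpa using this

theorem isIncrement_of_bound₃₂ {a : Inc 3 2} (hc : ContInc a) {C κ ρ β : ℝ} (hκ : 0 < κ)
    (hρ : 0 < ρ) (hβ : 0 < β) (hb : ∀ s t, |a s t| ≤ C * weight₃ κ ρ s * weight₂ β t) :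
    IsIncrement a := by
  refine ⟨hc, fun s t i j hij h => ?_, fun s t i j hij h => ?_⟩
  · have hs : weight₃ κ ρ s = 0 := by
      have : s 0 = s 1 ∨ s 1 = s 2 := by fin_cases i <;> fin_cases j <;> simp_all
      exact this.elim (weight₃_eq_zero_left hκ) (weight₃_eq_zero_right hρ)
    have := hb s t
    rw [hs] at this
    simpa using this
  · have hs : t 0 = t 1 := by fin_cases i <;> fin_cases j <;> simp_all
    have := hb s t
    rw [weight₂_eq_zero hβ hs] at this
    simpa using this

theorem isIncrement_of_bound₂₃ {a : Inc 2 3} (hc : ContInc a) {C κ ρ β : ℝ} (hκ : 0 < κ)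
    (hρ : 0 < ρ) (hβ : 0 < β) (hb : ∀ s t, |a s t| ≤ C * weight₂ β s * weight₃ κ ρ t) :
    IsIncrement a := by
  refine ⟨hc, fun s t i j hij h => ?_, fun s t i j hij h => ?_⟩
  · have hs : s 0 = s 1 := by fin_cases i <;> fin_cases j <;> simp_all
    have := hb s t
    rw [weight₂_eq_zero hβ hs] at this
    simpa using this
  · have hs : weight₃ κ ρ t = 0 := by
      have : t 0 = t 1 ∨ t 1 = t 2 := by fin_cases i <;> fin_cases j <;> simp_all
      exact this.elim (weight₃_eq_zero_left hκ) (weight₃_eq_zero_right hρ)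
    have := hb s t
    rw [hs] at this
    simpa using this

/-! ### Bounds for membership in `P32` and `P23` -/

/-- `P32` and `P23` require two exponents whose sum is exactly `μ`. Exponents with a larger sum are
scaled down proportionally, which only increases the weight because distances are at most `1`. -/
theorem weight₃_rebalance {a b μ : ℝ} (ha : 0 < a) (hb : 0 < b) (hμ : 0 < μ) (h : μ ≤ a + b)
    (s : Fin 3 → unitInterval) :
    weight₃ a b s ≤ weight₃ (μ * a / (a + b)) (μ - μ * a / (a + b)) s := by
  have hab : 0 < a + b := by linarith
  have h1 : μ * a / (a + b) ≤ a := by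
    rw [div_le_iff₀ hab]; nlinarith
  have h2 : μ - μ * a / (a + b) = μ * b / (a + b) := by field_simp; ring
  have h3 : μ * b / (a + b) ≤ b := by
    rw [div_le_iff₀ hab]; nlinarith
  rw [h2]
  have p1 : 0 < μ * a / (a + b) := by positivity
  have p2 : 0 < μ * b / (a + b) := by positivity
  unfold weight₃
  gcongr ?_ * ?_
  · exact Real.rpow_le_rpow_of_exponent_ge_of_imp (abs_nonneg _) (abs_sub_le_one _ _) h1
      (fun _ h0 => absurd h0 ha.ne')
  · exact Real.rpow_le_rpow_of_exponent_ge_of_imp (abs_nonneg _) (abs_sub_le_one _ _) h3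
      (fun _ h0 => absurd h0 hb.ne')

theorem P32_of_bounds {μ β C₁ C₂ a₁ b₁ a₂ b₂ : ℝ} (hμ : 0 < μ) (hβ : 0 < β) (hC₁ : 0 ≤ C₁)
    (hC₂ : 0 ≤ C₂) (ha₁ : 0 < a₁) (hb₁ : 0 < b₁) (ha₂ : 0 < a₂) (hb₂ : 0 < b₂)
    (h₁ : μ ≤ a₁ + b₁) (h₂ : μ ≤ a₂ + b₂) {H₁ H₂ : Inc 3 2} (hc₁ : ContInc H₁)
    (hc₂ : ContInc H₂) (hH₁ : ∀ s t, |H₁ s t| ≤ C₁ * weight₃ a₁ b₁ s * weight₂ β t)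
    (hH₂ : ∀ s t, |H₂ s t| ≤ C₂ * weight₃ a₂ b₂ s * weight₂ β t) : P32 μ β (H₁ + H₂) := by
  have aux : ∀ {a b : ℝ}, 0 < a → 0 < b → 0 < μ * a / (a + b) ∧ μ * a / (a + b) < μ := by
    intro a b ha hb
    refine ⟨by positivity, ?_⟩
    rw [div_lt_iff₀ (by positivity)]
    nlinarith
  refine ⟨2, ![μ * a₁ / (a₁ + b₁), μ * a₂ / (a₂ + b₂)], ![H₁, H₂], ?_, ?_⟩
  · rw [Fin.forall_fin_two]
    refine ⟨⟨(aux ha₁ hb₁).1, (aux ha₁ hb₁).2,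
      isIncrement_of_bound₃₂ hc₁ ha₁ hb₁ hβ hH₁, C₁, fun s t => (hH₁ s t).trans ?_⟩,
      ⟨(aux ha₂ hb₂).1, (aux ha₂ hb₂).2,
      isIncrement_of_bound₃₂ hc₂ ha₂ hb₂ hβ hH₂, C₂, fun s t => (hH₂ s t).trans ?_⟩⟩
    · exact mul_le_mul_of_nonneg_right (mul_le_mul_of_nonneg_left
        (weight₃_rebalance ha₁ hb₁ hμ h₁ s) hC₁) (weight₂_nonneg _ _)
    · exact mul_le_mul_of_nonneg_right (mul_le_mul_of_nonneg_left
        (weight₃_rebalance ha₂ hb₂ hμ h₂ s) hC₂) (weight₂_nonneg _ _)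
  · simp [Fin.sum_univ_two]

theorem P23_of_bounds {ν α C₁ C₂ a₁ b₁ a₂ b₂ : ℝ} (hν : 0 < ν) (hα : 0 < α) (hC₁ : 0 ≤ C₁)
    (hC₂ : 0 ≤ C₂) (ha₁ : 0 < a₁) (hb₁ : 0 < b₁) (ha₂ : 0 < a₂) (hb₂ : 0 < b₂)
    (h₁ : ν ≤ a₁ + b₁) (h₂ : ν ≤ a₂ + b₂) {H₁ H₂ : Inc 2 3} (hc₁ : ContInc H₁)
    (hc₂ : ContInc H₂) (hH₁ : ∀ s t, |H₁ s t| ≤ C₁ * weight₂ α s * weight₃ a₁ b₁ t)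
    (hH₂ : ∀ s t, |H₂ s t| ≤ C₂ * weight₂ α s * weight₃ a₂ b₂ t) : P23 α ν (H₁ + H₂) := by
  have aux : ∀ {a b : ℝ}, 0 < a → 0 < b → 0 < ν * a / (a + b) ∧ ν * a / (a + b) < ν := by
    intro a b ha hb
    refine ⟨by positivity, ?_⟩
    rw [div_lt_iff₀ (by positivity)]
    nlinarith
  refine ⟨2, ![ν * a₁ / (a₁ + b₁), ν * a₂ / (a₂ + b₂)], ![H₁, H₂], ?_, ?_⟩
  · rw [Fin.forall_fin_two]
    refine ⟨⟨(aux ha₁ hb₁).1, (aux ha₁ hb₁).2,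
      isIncrement_of_bound₂₃ hc₁ ha₁ hb₁ hα hH₁, C₁, fun s t => (hH₁ s t).trans ?_⟩,
      ⟨(aux ha₂ hb₂).1, (aux ha₂ hb₂).2,
      isIncrement_of_bound₂₃ hc₂ ha₂ hb₂ hα hH₂, C₂, fun s t => (hH₂ s t).trans ?_⟩⟩
    · exact mul_le_mul_of_nonneg_left (weight₃_rebalance ha₁ hb₁ hν h₁ t)
        (mul_nonneg hC₁ (weight₂_nonneg _ _))
    · exact mul_le_mul_of_nonneg_left (weight₃_rebalance ha₂ hb₂ hν h₂ t)
        (mul_nonneg hC₂ (weight₂_nonneg _ _))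
  · simp [Fin.sum_univ_two]

/-- Passing to the larger gap removes the exponents `κ i`, which differ between summands, and leaves
a single bound suited to sewing. -/
theorem P32.exists_gap {μ β : ℝ} {h : Inc 3 2} (hh : P32 μ β h) :
    ∃ C, 0 ≤ C ∧ ∀ s t, |h s t| ≤ C * weight₂ β t * gap s ^ μ := by
  obtain ⟨n, κ, H, hH, rfl⟩ := hh
  choose h1 h2 h3 C hC using hH
  refine ⟨∑ i, |C i|, Finset.sum_nonneg fun i _ => abs_nonneg _, fun s t => ?_⟩
  rw [Finset.sum_apply, Finset.sum_apply, Finset.sum_mul, Finset.sum_mul]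
  refine (Finset.abs_sum_le_sum_abs _ _).trans (Finset.sum_le_sum fun i _ => (hC i s t).trans ?_)
  have hw := weight₃_le_gap (ν := μ) (h1 i) (sub_pos.2 (h2 i)) (by simp) s
  have := weight₂_nonneg β t
  have := weight₃_nonneg (κ i) (μ - κ i) s
  calc _ ≤ |C i| * weight₃ (κ i) (μ - κ i) s * weight₂ β t := by gcongr; exact le_abs_self _
    _ ≤ |C i| * gap s ^ μ * weight₂ β t := by gcongr
    _ = _ := by ring

theorem P23.exists_gap {α ν : ℝ} {h : Inc 2 3} (hh : P23 α ν h) :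
    ∃ C, 0 ≤ C ∧ ∀ s t, |h s t| ≤ C * weight₂ α s * gap t ^ ν := by
  obtain ⟨n, κ, H, hH, rfl⟩ := hh
  choose h1 h2 h3 C hC using hH
  refine ⟨∑ i, |C i|, Finset.sum_nonneg fun i _ => abs_nonneg _, fun s t => ?_⟩
  rw [Finset.sum_apply, Finset.sum_apply, Finset.sum_mul, Finset.sum_mul]
  refine (Finset.abs_sum_le_sum_abs _ _).trans (Finset.sum_le_sum fun i _ => (hC i s t).trans ?_)
  have hw := weight₃_le_gap (ν := ν) (h1 i) (sub_pos.2 (h2 i)) (by simp) t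
  have := weight₂_nonneg α s
  have := weight₃_nonneg (κ i) (ν - κ i) t
  gcongr
  exact le_abs_self _

/-! ### Sewing of planar increments -/

/-- An increment of two variables in direction 2 to which the sewing lemma applies. -/
structure Sewable₂ {k : ℕ} (w : (Fin k → unitInterval) → ℝ) (ν : ℝ) (a : Inc k 2) : Prop where
  cont : ContInc a
  one_lt : 1 < ν
  diag : ∀ s x, a s ![x, x] = 0
  nonneg : ∀ s, 0 ≤ w s
  bdd : ∃ W, ∀ s, w s ≤ W
  bound : ∀ s t, |delta₂ a s t| ≤ w s * gap t ^ ν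

/-- Sewing in direction 2. -/
noncomputable def sew₂ {k : ℕ} (a : Inc k 2) : Inc k 2 := fun s t =>
  sew (fun x y => a s ![x, y]) (t 0) (t 1)

theorem Sewable₂.sewable {k : ℕ} {w : (Fin k → unitInterval) → ℝ} {ν : ℝ} {a : Inc k 2}
    (h : Sewable₂ w ν a) (s : Fin k → unitInterval) :
    Sewable (w s) ν (fun x y => a s ![x, y]) where
  nonneg := h.nonneg s
  one_lt := h.one_lt
  cont := h.cont.comp continuous_const (by fun_prop)
  diag := h.diag s
  bound x u y := by
    have := h.bound s ![x, u, y]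
    rw [delta₂_apply_two] at this
    exact this

theorem Sewable₂.contInc_sew₂ {k : ℕ} {w : (Fin k → unitInterval) → ℝ} {ν : ℝ} {a : Inc k 2}
    (h : Sewable₂ w ν a) : ContInc (sew₂ a) := by
  obtain ⟨W, hW⟩ := h.bdd
  have hc := continuous_sew (P := Fin k → unitInterval) (A := fun s x y => a s ![x, y])
    (K := W) (ν := ν) (h.cont.comp (by fun_prop) (by fun_prop)) (fun s =>
      { h.sewable s with
        nonneg := (h.nonneg s).trans (hW s)
        bound := fun x u y => ((h.sewable s).bound x u y).trans
          (mul_le_mul_of_nonneg_right (hW s)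
            (Real.rpow_nonneg ((abs_nonneg _).trans (le_max_left _ _)) _)) })
  exact hc.comp (f := fun p : (Fin k → unitInterval) × (Fin 2 → unitInterval) =>
    (p.1, p.2 0, p.2 1)) (by fun_prop)

theorem Sewable₂.delta₂_sew₂ {k : ℕ} {w : (Fin k → unitInterval) → ℝ} {ν : ℝ} {a : Inc k 2}
    (h : Sewable₂ w ν a) : delta₂ (sew₂ a) = 0 := by
  ext s t
  have := (h.sewable s).sew_add (t 0) (t 1) (t 2)
  rw [delta₂_apply_two, Pi.zero_apply, Pi.zero_apply, sub_sub, sub_eq_zero]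
  exact this.symm

theorem Sewable₂.abs_sub_sew₂_le {k : ℕ} {w : (Fin k → unitInterval) → ℝ} {ν : ℝ} {a : Inc k 2}
    (h : Sewable₂ w ν a) (s : Fin k → unitInterval) (t : Fin 2 → unitInterval) :
    |a s t - sew₂ a s t| ≤ sewConst ν * w s * weight₂ ν t := by
  have := (h.sewable s).abs_sub_sew_le (t 0) (t 1)
  simp only [vec_two] at this
  exact this

theorem sew₂_eq_of_additive {k : ℕ} {ν : ℝ} (hν : 1 < ν) {a L : Inc k 2} (hL : delta₂ L = 0)
    {K : (Fin k → unitInterval) → ℝ} (hb : ∀ s t, |a s t - L s t| ≤ K s * weight₂ ν t) :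
    sew₂ a = L := by
  ext s t
  have := sew_eq_of_additive (A := fun x y => a s ![x, y]) (L := fun x y => L s ![x, y])
    (K := K s) hν (fun x u y => ?_) (fun x y => hb s ![x, y]) (t 0) (t 1)
  · simp only [vec_two] at this
    exact this
  · have := congrFun (congrFun hL s) ![x, u, y]
    rw [delta₂_apply_two, Pi.zero_apply, Pi.zero_apply, sub_sub, sub_eq_zero] at this
    exact this.symm

theorem Sewable₂.sew₂_add {k : ℕ} {w w' : (Fin k → unitInterval) → ℝ} {ν : ℝ} {a b : Inc k 2}
    (ha : Sewable₂ w ν a) (hb : Sewable₂ w' ν b) : sew₂ (a + b) = sew₂ a + sew₂ b := by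
  refine sew₂_eq_of_additive ha.one_lt (K := fun s => sewConst ν * w s + sewConst ν * w' s)
    (by rw [delta₂_add, ha.delta₂_sew₂, hb.delta₂_sew₂, add_zero]) fun s t => ?_
  rw [Pi.add_apply, Pi.add_apply, Pi.add_apply, Pi.add_apply, add_sub_add_comm, add_mul]
  exact (abs_add_le _ _).trans (add_le_add (ha.abs_sub_sew₂_le s t) (hb.abs_sub_sew₂_le s t))

/-- An increment of two variables in direction 1 to which the sewing lemma applies. -/
structure Sewable₁ {l : ℕ} (w : (Fin l → unitInterval) → ℝ) (μ : ℝ) (a : Inc 2 l) : Prop where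
  cont : ContInc a
  one_lt : 1 < μ
  diag : ∀ x t, a ![x, x] t = 0
  nonneg : ∀ t, 0 ≤ w t
  bdd : ∃ W, ∀ t, w t ≤ W
  bound : ∀ s t, |delta₁ a s t| ≤ w t * gap s ^ μ

/-- Sewing in direction 1. -/
noncomputable def sew₁ {l : ℕ} (a : Inc 2 l) : Inc 2 l := fun s t =>
  sew (fun x y => a ![x, y] t) (s 0) (s 1)

theorem Sewable₁.sewable {l : ℕ} {w : (Fin l → unitInterval) → ℝ} {μ : ℝ} {a : Inc 2 l}
    (h : Sewable₁ w μ a) (t : Fin l → unitInterval) :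
    Sewable (w t) μ (fun x y => a ![x, y] t) where
  nonneg := h.nonneg t
  one_lt := h.one_lt
  cont := h.cont.comp (by fun_prop) continuous_const
  diag x := h.diag x t
  bound x u y := by
    have := h.bound ![x, u, y] t
    rw [delta₁_apply_two] at this
    exact this

theorem Sewable₁.contInc_sew₁ {l : ℕ} {w : (Fin l → unitInterval) → ℝ} {μ : ℝ} {a : Inc 2 l}
    (h : Sewable₁ w μ a) : ContInc (sew₁ a) := by
  obtain ⟨W, hW⟩ := h.bdd
  have hc := continuous_sew (P := Fin l → unitInterval) (A := fun t x y => a ![x, y] t)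
    (K := W) (ν := μ) (h.cont.comp (by fun_prop) (by fun_prop)) (fun t =>
      { h.sewable t with
        nonneg := (h.nonneg t).trans (hW t)
        bound := fun x u y => ((h.sewable t).bound x u y).trans
          (mul_le_mul_of_nonneg_right (hW t)
            (Real.rpow_nonneg ((abs_nonneg _).trans (le_max_left _ _)) _)) })
  exact hc.comp (f := fun p : (Fin 2 → unitInterval) × (Fin l → unitInterval) =>
    (p.2, p.1 0, p.1 1)) (by fun_prop)

theorem Sewable₁.delta₁_sew₁ {l : ℕ} {w : (Fin l → unitInterval) → ℝ} {μ : ℝ} {a : Inc 2 l}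
    (h : Sewable₁ w μ a) : delta₁ (sew₁ a) = 0 := by
  ext s t
  have := (h.sewable t).sew_add (s 0) (s 1) (s 2)
  rw [delta₁_apply_two, Pi.zero_apply, Pi.zero_apply, sub_sub, sub_eq_zero]
  exact this.symm

theorem Sewable₁.abs_sub_sew₁_le {l : ℕ} {w : (Fin l → unitInterval) → ℝ} {μ : ℝ} {a : Inc 2 l}
    (h : Sewable₁ w μ a) (s : Fin 2 → unitInterval) (t : Fin l → unitInterval) :
    |a s t - sew₁ a s t| ≤ sewConst μ * w t * weight₂ μ s := by
  have := (h.sewable t).abs_sub_sew_le (s 0) (s 1)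
  simp only [vec_two] at this
  exact this

theorem sew₁_eq_of_additive {l : ℕ} {μ : ℝ} (hμ : 1 < μ) {a L : Inc 2 l} (hL : delta₁ L = 0)
    {K : (Fin l → unitInterval) → ℝ} (hb : ∀ s t, |a s t - L s t| ≤ K t * weight₂ μ s) :
    sew₁ a = L := by
  ext s t
  have := sew_eq_of_additive (A := fun x y => a ![x, y] t) (L := fun x y => L ![x, y] t)
    (K := K t) hμ (fun x u y => ?_) (fun x y => hb ![x, y] t) (s 0) (s 1)
  · simp only [vec_two] at this
    exact this
  · have := congrFun (congrFun hL ![x, u, y]) t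
    rw [delta₁_apply_two, Pi.zero_apply, Pi.zero_apply, sub_sub, sub_eq_zero] at this
    exact this.symm

/-- `delta₁ (sew₂ a)` is additive in direction 2 and close to `delta₁ a`, one sewing error for each
of the three terms of `delta₁`; uniqueness concludes. -/
theorem Sewable₂.sew₂_delta₁ {w : (Fin 2 → unitInterval) → ℝ} {ν : ℝ} {a : Inc 2 2}
    (ha : Sewable₂ w ν a) : sew₂ (delta₁ a) = delta₁ (sew₂ a) := by
  refine sew₂_eq_of_additive ha.one_lt (K := fun s => sewConst ν * w ![s 0, s 2] +
      sewConst ν * w ![s 0, s 1] + sewConst ν * w ![s 1, s 2])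
    (by rw [← delta₁_delta₂, ha.delta₂_sew₂, delta₁_zero]) fun s t => ?_
  have h1 := abs_le.1 (ha.abs_sub_sew₂_le ![s 0, s 2] t)
  have h2 := abs_le.1 (ha.abs_sub_sew₂_le ![s 0, s 1] t)
  have h3 := abs_le.1 (ha.abs_sub_sew₂_le ![s 1, s 2] t)
  rw [delta₁_apply_two, delta₁_apply_two, abs_le]
  constructor <;> linarith [h1.1, h1.2, h2.1, h2.2, h3.1, h3.2]

/-! ### The sewing maps -/

theorem IsIncrement.diag₂ {a : Inc 2 2} (h : IsIncrement a) (s : Fin 2 → unitInterval)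
    (x : unitInterval) : a s ![x, x] = 0 := h.2.2 s ![x, x] 0 1 rfl rfl

theorem IsIncrement.diag₁ {a : Inc 2 2} (h : IsIncrement a) (x : unitInterval)
    (t : Fin 2 → unitInterval) : a ![x, x] t = 0 := h.2.1 ![x, x] t 0 1 rfl rfl

theorem sewable₂_of_P23 {a : Inc 2 2} (ha : IsIncrement a) {α ν : ℝ} (hα : 0 < α) (hν : 1 < ν)
    (h : P23 α ν (delta₂ a)) :
    ∃ C, 0 ≤ C ∧ Sewable₂ (fun s => C * weight₂ α s) ν a := by
  obtain ⟨C, hC, hb⟩ := h.exists_gap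
  exact ⟨C, hC, ha.1, hν, ha.diag₂, fun s => mul_nonneg hC (weight₂_nonneg _ _),
    ⟨C, fun s => mul_le_of_le_one_right hC (weight₂_le_one hα.le s)⟩, hb⟩

theorem sewable₁_of_P32 {a : Inc 2 2} (ha : IsIncrement a) {μ β : ℝ} (hβ : 0 < β) (hμ : 1 < μ)
    (h : P32 μ β (delta₁ a)) :
    ∃ C, 0 ≤ C ∧ Sewable₁ (fun t => C * weight₂ β t) μ a := by
  obtain ⟨C, hC, hb⟩ := h.exists_gap
  exact ⟨C, hC, ha.1, hμ, ha.diag₁, fun s => mul_nonneg hC (weight₂_nonneg _ _),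
    ⟨C, fun s => mul_le_of_le_one_right hC (weight₂_le_one hβ.le s)⟩, hb⟩

/-- `a - R` is additive and close to `a`, whatever exponents witness `Sews₂`; hence the choice made
in `Lambda₂` is immaterial. -/
theorem eq_of_sews₂ {a R : Inc 2 2} (h : Sews₂ (delta₂ a) R) : R = a - sew₂ a := by
  obtain ⟨α, ν, hα, hν, -, -, ⟨-, C, hC⟩, hR⟩ := h
  have := sew₂_eq_of_additive (a := a) (L := a - R) hν (by rw [delta₂_sub, hR, sub_self])
    (K := fun s => C * weight₂ α s) (fun s t => by
      rw [Pi.sub_apply, Pi.sub_apply, sub_sub_cancel]; exact hC s t)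
  rw [this, sub_sub_cancel]

theorem eq_of_sews₁ {a R : Inc 2 2} (h : Sews₁ (delta₁ a) R) : R = a - sew₁ a := by
  obtain ⟨μ, β, hμ, hβ, -, -, ⟨-, C, hC⟩, hR⟩ := h
  have := sew₁_eq_of_additive (a := a) (L := a - R) hμ (by rw [delta₁_sub, hR, sub_self])
    (K := fun t => C * weight₂ β t) (fun s t => by
      rw [Pi.sub_apply, Pi.sub_apply, sub_sub_cancel]; exact (hC s t).trans (le_of_eq (by ring)))
  rw [this, sub_sub_cancel]

theorem existsUnique_sews₂ {a : Inc 2 2} (ha : IsIncrement a) {α ν : ℝ} (hα : 0 < α)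
    (hν : 1 < ν) (h : P23 α ν (delta₂ a)) : ∃! R, Sews₂ (delta₂ a) R := by
  obtain ⟨C, hC, hs⟩ := sewable₂_of_P23 ha hα hν h
  have hb : ∀ s t, |(a - sew₂ a) s t| ≤ sewConst ν * C * weight₂ α s * weight₂ ν t := fun s t =>
    (hs.abs_sub_sew₂_le s t).trans (le_of_eq (by ring))
  exact ⟨a - sew₂ a, ⟨α, ν, hα, hν, h, ⟨a, ha, rfl⟩,
    ⟨isIncrement_of_bound₂₂ (ContInc.sub ha.1 hs.contInc_sew₂) hα (by linarith) hb, _, hb⟩,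
    by rw [delta₂_sub, hs.delta₂_sew₂, sub_zero]⟩, fun R hR => eq_of_sews₂ hR⟩

theorem existsUnique_sews₁ {a : Inc 2 2} (ha : IsIncrement a) {μ β : ℝ} (hβ : 0 < β)
    (hμ : 1 < μ) (h : P32 μ β (delta₁ a)) : ∃! R, Sews₁ (delta₁ a) R := by
  obtain ⟨C, hC, hs⟩ := sewable₁_of_P32 ha hβ hμ h
  have hb : ∀ s t, |(a - sew₁ a) s t| ≤ sewConst μ * C * weight₂ μ s * weight₂ β t := fun s t =>
    (hs.abs_sub_sew₁_le s t).trans (le_of_eq (by ring))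
  exact ⟨a - sew₁ a, ⟨μ, β, hμ, hβ, h, ⟨a, ha, rfl⟩,
    ⟨isIncrement_of_bound₂₂ (ContInc.sub ha.1 hs.contInc_sew₁) (by linarith) hβ hb, _, hb⟩,
    by rw [delta₁_sub, hs.delta₁_sew₁, sub_zero]⟩, fun R hR => eq_of_sews₁ hR⟩

theorem integ₂_eq_sew₂ {a : Inc 2 2} (h : ∃ R, Sews₂ (delta₂ a) R) : integ₂ a = sew₂ a := by
  rw [integ₂, Lambda₂, dif_pos h, eq_of_sews₂ h.choose_spec, sub_sub_cancel]

theorem integ₁_eq_sew₁ {a : Inc 2 2} (h : ∃ R, Sews₁ (delta₁ a) R) : integ₁ a = sew₁ a := by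
  rw [integ₁, Lambda₁, dif_pos h, eq_of_sews₁ h.choose_spec, sub_sub_cancel]

/-! ### Subdivisions -/

theorem sum_fin_telescope (n : ℕ) (J : Fin (n + 1) → ℝ) :
    ∑ i : Fin n, (J i.succ - J i.castSucc) = J (Fin.last n) - J 0 := by
  induction n with
  | zero => simp
  | succ n ih =>
    rw [Fin.sum_univ_castSucc]
    have := ih fun i => J i.castSucc
    simp only [← Fin.succ_castSucc] at this
    rw [this]
    simp

theorem Subdivision.sum_additive {a b : unitInterval} (p : Subdivision a b)
    {L : unitInterval → unitInterval → ℝ} (hL : ∀ x u y, L x u + L u y = L x y) :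
    ∑ i : Fin p.n, L (p.pt i.castSucc) (p.pt i.succ) = L a b := by
  have h := sum_fin_telescope p.n (fun i => L 0 (p.pt i))
  rw [p.first, p.last] at h
  rw [show L a b = L 0 b - L 0 a by linarith [hL 0 a b], ← h]
  exact Finset.sum_congr rfl fun i _ => by linarith [hL 0 (p.pt i.castSucc) (p.pt i.succ)]

theorem Subdivision.le_mesh {a b : unitInterval} (p : Subdivision a b) (i : Fin p.n) :
    ((p.pt i.succ : ℝ) - p.pt i.castSucc) ≤ p.mesh :=
  le_ciSup (f := fun i : Fin p.n => ((p.pt i.succ : ℝ) - p.pt i.castSucc))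
    (Set.finite_range _).bddAbove i

theorem Subdivision.step_nonneg {a b : unitInterval} (p : Subdivision a b) (i : Fin p.n) :
    0 ≤ ((p.pt i.succ : ℝ) - p.pt i.castSucc) :=
  sub_nonneg.2 (p.mono i.castSucc_lt_succ.le)

theorem Subdivision.mesh_nonneg {a b : unitInterval} (p : Subdivision a b) : 0 ≤ p.mesh :=
  Real.iSup_nonneg p.step_nonneg

theorem Subdivision.sum_sub_le_one {a b : unitInterval} (p : Subdivision a b) :
    ∑ i : Fin p.n, ((p.pt i.succ : ℝ) - p.pt i.castSucc) ≤ 1 := by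
  rw [sum_fin_telescope p.n (fun i => (p.pt i : ℝ)), p.first, p.last]
  exact (le_abs_self _).trans (abs_sub_le_one a b)

theorem Subdivision.sum_rpow_le {a b : unitInterval} (p : Subdivision a b) {μ : ℝ} (hμ : 1 < μ) :
    ∑ i : Fin p.n, |(p.pt i.succ : ℝ) - p.pt i.castSucc| ^ μ ≤ p.mesh ^ (μ - 1) := by
  have hm := Real.rpow_nonneg p.mesh_nonneg (μ - 1)
  calc _ ≤ ∑ i : Fin p.n, p.mesh ^ (μ - 1) * ((p.pt i.succ : ℝ) - p.pt i.castSucc) := by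
        refine Finset.sum_le_sum fun i _ => ?_
        have h0 := p.step_nonneg i
        rw [abs_of_nonneg h0]
        -- Repeated points are allowed in a subdivision, and splitting off one power requires a
        -- positive step.
        rcases h0.eq_or_lt with h | h
        · rw [← h, Real.zero_rpow (by linarith), mul_zero]
        · calc _ = ((p.pt i.succ : ℝ) - p.pt i.castSucc) ^ (μ - 1) *
                ((p.pt i.succ : ℝ) - p.pt i.castSucc) := by
                rw [← Real.rpow_add_one h.ne', sub_add_cancel]
            _ ≤ _ := by
                gcongr
                exact p.le_mesh i
    _ = p.mesh ^ (μ - 1) * ∑ i : Fin p.n, ((p.pt i.succ : ℝ) - p.pt i.castSucc) := by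
        rw [Finset.mul_sum]
    _ ≤ _ := mul_le_of_le_one_right hm p.sum_sub_le_one

theorem Subdivision.mesh_le_one {a b : unitInterval} (p : Subdivision a b) : p.mesh ≤ 1 :=
  Real.iSup_le (fun _ => (le_abs_self _).trans (abs_sub_le_one _ _)) zero_le_one

/-- The bound does not depend on the partition: the sum differs from `sew A a b` by at most
`sewConst μ * K`, and `sew A a b` from `A a b` by as much again. -/
theorem Sewable.abs_sum_le {K μ : ℝ} {A : unitInterval → unitInterval → ℝ} (h : Sewable K μ A)
    {K' : ℝ} (hK' : ∀ x y, |A x y| ≤ K') {a b : unitInterval} (p : Subdivision a b) :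
    |∑ i : Fin p.n, A (p.pt i.castSucc) (p.pt i.succ)| ≤ K' + 2 * (sewConst μ * K) := by
  have hS := sewConst_pos h.one_lt
  have hK := h.nonneg
  have hμ := h.one_lt
  have e : ∑ i : Fin p.n, A (p.pt i.castSucc) (p.pt i.succ) = (A a b - (A a b - sew A a b)) +
      ∑ i : Fin p.n, (A (p.pt i.castSucc) (p.pt i.succ) -
        sew A (p.pt i.castSucc) (p.pt i.succ)) := by
    rw [Finset.sum_sub_distrib, p.sum_additive h.sew_add]
    ring
  have h1 : |A a b - (A a b - sew A a b)| ≤ K' + sewConst μ * K := by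
    refine (abs_sub _ _).trans (add_le_add (hK' a b) ((h.abs_sub_sew_le a b).trans ?_))
    exact mul_le_of_le_one_right (by positivity)
      (Real.rpow_le_one (abs_nonneg _) (abs_sub_le_one _ _) (by linarith))
  have h2 : |∑ i : Fin p.n, (A (p.pt i.castSucc) (p.pt i.succ) -
        sew A (p.pt i.castSucc) (p.pt i.succ))| ≤ sewConst μ * K := by
    refine (Finset.abs_sum_le_sum_abs _ _).trans ?_
    refine (Finset.sum_le_sum fun i _ => h.abs_sub_sew_le _ _).trans ?_
    rw [← Finset.mul_sum]
    refine mul_le_of_le_one_right (by positivity) ((p.sum_rpow_le hμ).trans ?_)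
    exact Real.rpow_le_one p.mesh_nonneg p.mesh_le_one (by linarith)
  rw [e]
  refine (abs_add_le _ _).trans ?_
  linarith

/-! ### Germs -/

/-- A summand of `δ₁ a` for a germ `a` of a double integral. -/
def IsGermPart (μ β ν : ℝ) (H : Inc 3 2) : Prop :=
  ∃ a b C : ℝ, 0 < a ∧ 0 < b ∧ 0 ≤ C ∧ μ ≤ a + b ∧ ContInc H ∧
    (∀ s t, |H s t| ≤ C * weight₃ a b s * weight₂ β t) ∧
    ∀ s t, |delta₂ H s t| ≤ C * weight₃ a b s * gap t ^ ν

/-- The estimates on a germ that allow to integrate it in direction 2 and then in direction 1. -/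
structure IsGerm (α μ β ν : ℝ) (a : Inc 2 2) : Prop where
  α_pos : 0 < α
  β_pos : 0 < β
  one_lt_μ : 1 < μ
  one_lt_ν : 1 < ν
  β_le : β ≤ ν
  cont : ContInc a
  bound : ∃ C, 0 ≤ C ∧ ∀ s t, |a s t| ≤ C * weight₂ α s * weight₂ β t
  mem : P23 α ν (delta₂ a)
  split : ∃ H₁ H₂ : Inc 3 2, IsGermPart μ β ν H₁ ∧ IsGermPart μ β ν H₂ ∧ delta₁ a = H₁ + H₂

theorem sewable₂_of_bounds {H : Inc 3 2} {a b C β ν : ℝ} (ha : 0 < a) (hb : 0 < b) (hC : 0 ≤ C)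
    (hβ : 0 < β) (hν : 1 < ν) (hc : ContInc H)
    (hH : ∀ s t, |H s t| ≤ C * weight₃ a b s * weight₂ β t)
    (hd : ∀ s t, |delta₂ H s t| ≤ C * weight₃ a b s * gap t ^ ν) :
    Sewable₂ (fun s => C * weight₃ a b s) ν H :=
  ⟨hc, hν, fun s x => by
    have := hH s ![x, x]
    rw [weight₂_eq_zero hβ (by rfl)] at this
    simpa using this, fun s => mul_nonneg hC (weight₃_nonneg _ _ _),
    ⟨C, fun s => mul_le_of_le_one_right hC (weight₃_le_one ha.le hb.le s)⟩, hd⟩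

theorem abs_sew₂_le {k : ℕ} {H : Inc k 2} {w : (Fin k → unitInterval) → ℝ} {β ν : ℝ}
    (hβ : 0 < β) (hβν : β ≤ ν) (h : Sewable₂ w ν H)
    (hH : ∀ s t, |H s t| ≤ w s * weight₂ β t) (s : Fin k → unitInterval)
    (t : Fin 2 → unitInterval) : |sew₂ H s t| ≤ (1 + sewConst ν) * w s * weight₂ β t := by
  have h1 := h.abs_sub_sew₂_le s t
  have h2 : sewConst ν * w s * weight₂ ν t ≤ sewConst ν * w s * weight₂ β t :=
    mul_le_mul_of_nonneg_left (weight₂_anti hβ hβν t)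
      (mul_nonneg (sewConst_pos h.one_lt).le (h.nonneg s))
  have h3 : |sew₂ H s t| ≤ |H s t| + |H s t - sew₂ H s t| := by
    have := abs_sub (H s t) (H s t - sew₂ H s t)
    rwa [sub_sub_cancel] at this
  have := hH s t
  linarith

namespace IsGerm

variable {α μ β ν : ℝ} {a : Inc 2 2}

theorem isIncrement (h : IsGerm α μ β ν a) : IsIncrement a := by
  obtain ⟨C, -, hC⟩ := h.bound
  exact isIncrement_of_bound₂₂ h.cont h.α_pos h.β_pos hC

theorem existsUnique_sews₂ (h : IsGerm α μ β ν a) : ∃! R, Sews₂ (delta₂ a) R :=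
  PlanarYoung.existsUnique_sews₂ h.isIncrement h.α_pos h.one_lt_ν h.mem

theorem integ₂_eq (h : IsGerm α μ β ν a) : integ₂ a = sew₂ a :=
  integ₂_eq_sew₂ h.existsUnique_sews₂.exists

theorem exists_sewable₂ (h : IsGerm α μ β ν a) :
    ∃ C, 0 ≤ C ∧ Sewable₂ (fun s => C * weight₂ α s) ν a :=
  sewable₂_of_P23 h.isIncrement h.α_pos h.one_lt_ν h.mem

theorem isIncrement_sew₂ (h : IsGerm α μ β ν a) : IsIncrement (sew₂ a) := by
  obtain ⟨C, hC, hs⟩ := h.exists_sewable₂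
  obtain ⟨C', hC', hb⟩ := h.bound
  -- `abs_sew₂_le` needs one weight for both `a` and `delta₂ a`, hence the sum of the two constants.
  have hs' : Sewable₂ (fun s => (C + C') * weight₂ α s) ν a :=
    { hs with
      nonneg := fun s => mul_nonneg (by linarith) (weight₂_nonneg _ _)
      bdd := ⟨C + C', fun s => mul_le_of_le_one_right (by linarith)
        (weight₂_le_one h.α_pos.le s)⟩
      bound := fun s t => (hs.bound s t).trans (by
        have := weight₂_nonneg α s
        have := Real.rpow_nonneg (gap_nonneg t) ν
        gcongr
        linarith) }
  refine isIncrement_of_bound₂₂ (C := (1 + sewConst ν) * (C + C')) hs.contInc_sew₂ h.α_pos h.β_pos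
    fun s t => ?_
  refine (abs_sew₂_le h.β_pos h.β_le hs' (fun s t => (hb s t).trans ?_) s t).trans
    (le_of_eq (by ring))
  have := weight₂_nonneg α s
  have := weight₂_nonneg β t
  gcongr
  linarith

/-- Commuting `δ₁` with sewing and sewing the two parts of `δ₁ a` separately lets each keep its own
weight in direction 1. -/
theorem P32_delta₁_sew₂ (h : IsGerm α μ β ν a) : P32 μ β (delta₁ (sew₂ a)) := by
  obtain ⟨C, hC, hs⟩ := h.exists_sewable₂
  obtain ⟨H₁, H₂, ⟨a₁, b₁, C₁, ha₁, hb₁, hC₁, hμ₁, hc₁, hH₁, hd₁⟩,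
    ⟨a₂, b₂, C₂, ha₂, hb₂, hC₂, hμ₂, hc₂, hH₂, hd₂⟩, hsum⟩ := h.split
  have s₁ := sewable₂_of_bounds ha₁ hb₁ hC₁ h.β_pos h.one_lt_ν hc₁ hH₁ hd₁
  have s₂ := sewable₂_of_bounds ha₂ hb₂ hC₂ h.β_pos h.one_lt_ν hc₂ hH₂ hd₂
  have hS := sewConst_pos h.one_lt_ν
  rw [← hs.sew₂_delta₁, hsum, s₁.sew₂_add s₂]
  refine P32_of_bounds (C₁ := (1 + sewConst ν) * C₁) (C₂ := (1 + sewConst ν) * C₂)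
    (by linarith [h.one_lt_μ]) h.β_pos (by positivity) (by positivity) ha₁ hb₁ ha₂ hb₂ hμ₁ hμ₂
    s₁.contInc_sew₂ s₂.contInc_sew₂ (fun s t => ?_) (fun s t => ?_)
  · exact (abs_sew₂_le h.β_pos h.β_le s₁ hH₁ s t).trans (le_of_eq (by ring))
  · exact (abs_sew₂_le h.β_pos h.β_le s₂ hH₂ s t).trans (le_of_eq (by ring))

theorem existsUnique_sews₁ (h : IsGerm α μ β ν a) : ∃! R, Sews₁ (delta₁ (sew₂ a)) R :=
  PlanarYoung.existsUnique_sews₁ h.isIncrement_sew₂ h.β_pos h.one_lt_μ h.P32_delta₁_sew₂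

theorem exists_sewable₁ (h : IsGerm α μ β ν a) :
    ∃ C, 0 ≤ C ∧ Sewable₁ (fun t => C * weight₂ β t) μ (sew₂ a) :=
  sewable₁_of_P32 h.isIncrement_sew₂ h.β_pos h.one_lt_μ h.P32_delta₁_sew₂

theorem integ_eq (h : IsGerm α μ β ν a) : integ a = sew₁ (sew₂ a) := by
  rw [integ, h.integ₂_eq, integ₁_eq_sew₁ h.existsUnique_sews₁.exists]

theorem integDefined (h : IsGerm α μ β ν a) : IntegDefined a := by
  refine ⟨h.isIncrement, h.existsUnique_sews₂, ?_⟩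
  rw [h.integ₂_eq]
  exact h.existsUnique_sews₁

/-- The remainder of the integration in direction 2 can be summed in direction 1. -/
theorem exists_sewable₁_remainder (h : IsGerm α μ β ν a) :
    ∃ C, 0 ≤ C ∧ (∀ s t, |(a - sew₂ a) s t| ≤ C * weight₂ ν t) ∧
      ∀ t, Sewable (C * weight₂ ν t) μ (fun x y => (a - sew₂ a) ![x, y] t) := by
  obtain ⟨C, hC, hs⟩ := h.exists_sewable₂
  obtain ⟨H₁, H₂, ⟨a₁, b₁, C₁, ha₁, hb₁, hC₁, hμ₁, hc₁, hH₁, hd₁⟩,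
    ⟨a₂, b₂, C₂, ha₂, hb₂, hC₂, hμ₂, hc₂, hH₂, hd₂⟩, hsum⟩ := h.split
  have s₁ := sewable₂_of_bounds ha₁ hb₁ hC₁ h.β_pos h.one_lt_ν hc₁ hH₁ hd₁
  have s₂ := sewable₂_of_bounds ha₂ hb₂ hC₂ h.β_pos h.one_lt_ν hc₂ hH₂ hd₂
  have hS := sewConst_pos h.one_lt_ν
  -- `δ₁` of the remainder is the sum of the sewing errors of `H₁` and `H₂`, small in both
  -- directions at once.
  have hd : ∀ s t, |delta₁ (a - sew₂ a) s t| ≤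
      sewConst ν * (C₁ + C₂) * weight₂ ν t * gap s ^ μ := by
    intro s t
    rw [delta₁_sub, ← hs.sew₂_delta₁, hsum, s₁.sew₂_add s₂, add_sub_add_comm]
    have hw := weight₂_nonneg ν t
    have e₁ := (s₁.abs_sub_sew₂_le s t).trans (mul_le_mul_of_nonneg_right
      (mul_le_mul_of_nonneg_left (mul_le_mul_of_nonneg_left (weight₃_le_gap ha₁ hb₁ hμ₁ s) hC₁)
        hS.le) hw)
    have e₂ := (s₂.abs_sub_sew₂_le s t).trans (mul_le_mul_of_nonneg_right
      (mul_le_mul_of_nonneg_left (mul_le_mul_of_nonneg_left (weight₃_le_gap ha₂ hb₂ hμ₂ s) hC₂)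
        hS.le) hw)
    refine (abs_add_le _ _).trans ((add_le_add e₁ e₂).trans (le_of_eq (by ring)))
  have hinc : ∀ x t, (a - sew₂ a) ![x, x] t = 0 := fun x t => by
    rw [Pi.sub_apply, Pi.sub_apply, h.isIncrement.diag₁, h.isIncrement_sew₂.diag₁, sub_zero]
  refine ⟨sewConst ν * (C + (C₁ + C₂)), by positivity, fun s t => ?_, fun t => ?_⟩
  · refine (hs.abs_sub_sew₂_le s t).trans (mul_le_mul_of_nonneg_right
      (mul_le_mul_of_nonneg_left ?_ hS.le) (weight₂_nonneg _ _))
    exact (mul_le_of_le_one_right hC (weight₂_le_one h.α_pos.le s)).trans (by linarith)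
  · refine ⟨mul_nonneg (by positivity) (weight₂_nonneg _ _), h.one_lt_μ,
      (h.cont.sub hs.contInc_sew₂).comp (by fun_prop) continuous_const, fun x => hinc x t,
      fun x u y => ?_⟩
    have := hd ![x, u, y] t
    rw [delta₁_apply_two] at this
    refine this.trans ?_
    exact mul_le_mul_of_nonneg_right (mul_le_mul_of_nonneg_right
      (mul_le_mul_of_nonneg_left (by linarith) hS.le) (weight₂_nonneg _ _))
      (Real.rpow_nonneg (gap_nonneg _) μ)

theorem riemannLimit (h : IsGerm α μ β ν a) (s₁ s₂ t₁ t₂ : unitInterval) :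
    RiemannLimit s₁ s₂ t₁ t₂ (fun s s' t t' => a ![s, s'] ![t, t'])
      (integ a ![s₁, s₂] ![t₁, t₂]) := by
  rw [h.integ_eq]
  obtain ⟨C, hC, hs₂⟩ := h.exists_sewable₂
  obtain ⟨C', hC', hs₁⟩ := h.exists_sewable₁
  obtain ⟨D, hD, hb, hr⟩ := h.exists_sewable₁_remainder
  have hμ := h.one_lt_μ
  have hν := h.one_lt_ν
  have hSμ := sewConst_pos hμ
  have hL₂ : ∀ s, ∀ x u y, sew₂ a s ![x, u] + sew₂ a s ![u, y] = sew₂ a s ![x, y] :=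
    fun s x u y => (hs₂.sewable s).sew_add x u y
  have hL₁ : ∀ t, ∀ x u y, sew₁ (sew₂ a) ![x, u] t + sew₁ (sew₂ a) ![u, y] t =
      sew₁ (sew₂ a) ![x, y] t := fun t x u y => (hs₁.sewable t).sew_add x u y
  -- the sum of the remainders of the integration in direction 2
  have hR₂ : ∀ (p : Subdivision s₁ s₂) (q : Subdivision t₁ t₂),
      |∑ i : Fin p.n, ∑ j : Fin q.n, (a - sew₂ a) ![p.pt i.castSucc, p.pt i.succ]
        ![q.pt j.castSucc, q.pt j.succ]| ≤ (D + 2 * (sewConst μ * D)) * q.mesh ^ (ν - 1) := by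
    intro p q
    -- Direction 1 is summed for each fixed `j`, at a cost independent of `p`; the factor `|t' - t|
    -- ^ ν` is then summed over `j`.
    rw [Finset.sum_comm]
    refine (Finset.abs_sum_le_sum_abs _ _).trans ?_
    calc _ ≤ ∑ j : Fin q.n, (D + 2 * (sewConst μ * D)) *
          |(q.pt j.succ : ℝ) - q.pt j.castSucc| ^ ν := by
          refine Finset.sum_le_sum fun j _ => ?_
          refine ((hr _).abs_sum_le (fun x y => hb ![x, y] _) p).trans (le_of_eq ?_)
          simp only [weight₂, Matrix.cons_val_zero, Matrix.cons_val_one]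
          ring
      _ ≤ _ := by
          rw [← Finset.mul_sum]
          exact mul_le_mul_of_nonneg_left (q.sum_rpow_le hν) (by positivity)
  -- the sum of the remainders of the integration in direction 1
  have hR₁ : ∀ (p : Subdivision s₁ s₂) (q : Subdivision t₁ t₂),
      |(∑ i : Fin p.n, ∑ j : Fin q.n, sew₂ a ![p.pt i.castSucc, p.pt i.succ]
        ![q.pt j.castSucc, q.pt j.succ]) - sew₁ (sew₂ a) ![s₁, s₂] ![t₁, t₂]| ≤
        sewConst μ * C' * p.mesh ^ (μ - 1) := by
    intro p q
    have e : ∀ i : Fin p.n, ∑ j : Fin q.n, sew₂ a ![p.pt i.castSucc, p.pt i.succ]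
        ![q.pt j.castSucc, q.pt j.succ] = sew₂ a ![p.pt i.castSucc, p.pt i.succ] ![t₁, t₂] :=
      fun i => q.sum_additive (L := fun x y => sew₂ a _ ![x, y]) (hL₂ _)
    rw [Finset.sum_congr rfl fun i _ => e i,
      ← p.sum_additive (L := fun x y => sew₁ (sew₂ a) ![x, y] ![t₁, t₂]) (hL₁ _),
      ← Finset.sum_sub_distrib]
    refine (Finset.abs_sum_le_sum_abs _ _).trans ?_
    calc _ ≤ ∑ i : Fin p.n, sewConst μ * C' * |(p.pt i.succ : ℝ) - p.pt i.castSucc| ^ μ := by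
          refine Finset.sum_le_sum fun i _ => (hs₁.abs_sub_sew₁_le _ _).trans ?_
          simp only [weight₂, Matrix.cons_val_zero, Matrix.cons_val_one]
          refine mul_le_mul_of_nonneg_right (mul_le_mul_of_nonneg_left ?_ hSμ.le)
            (Real.rpow_nonneg (abs_nonneg _) _)
          exact mul_le_of_le_one_right hC' (Real.rpow_le_one (abs_nonneg _)
            (abs_sub_le_one _ _) h.β_pos.le)
      _ ≤ _ := by
          rw [← Finset.mul_sum]
          exact mul_le_mul_of_nonneg_left (p.sum_rpow_le hμ) (by positivity)
  have hlim : ∀ {c e : ℝ}, 1 < e → ∀ ε > 0, ∃ η > 0, ∀ x, 0 ≤ x → x < η →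
      c * x ^ (e - 1) < ε := by
    intro c e he ε hε
    have hc : ContinuousAt (fun x : ℝ => c * x ^ (e - 1)) 0 :=
      continuousAt_const.mul (Real.continuousAt_rpow_const _ _ (Or.inr (by linarith)))
    obtain ⟨η, hη, hx⟩ := Metric.continuousAt_iff.1 hc ε hε
    refine ⟨η, hη, fun x h0 h1 => ?_⟩
    have := hx (x := x) (by rwa [Real.dist_eq, sub_zero, abs_of_nonneg h0])
    rw [Real.zero_rpow (by linarith), mul_zero, Real.dist_eq, sub_zero] at this
    exact (le_abs_self _).trans_lt this
  intro ε hε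
  obtain ⟨η₁, hη₁, h₁⟩ := hlim (c := sewConst μ * C') hμ (ε / 2) (by linarith)
  obtain ⟨η₂, hη₂, h₂⟩ := hlim (c := D + 2 * (sewConst μ * D)) hν (ε / 2) (by linarith)
  refine ⟨min η₁ η₂, lt_min hη₁ hη₂, fun p q hp hq => ?_⟩
  have k₁ := (hR₁ p q).trans_lt (h₁ _ p.mesh_nonneg (hp.trans_le (min_le_left _ _)))
  have k₂ := (hR₂ p q).trans_lt (h₂ _ q.mesh_nonneg (hq.trans_le (min_le_right _ _)))
  simp only [Pi.sub_apply, Finset.sum_sub_distrib] at k₂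
  rw [abs_lt] at *
  constructor <;> linarith [k₁.1, k₁.2, k₂.1, k₂.2]

end IsGerm

/-! ### Young germs in direction 2 -/

/-- Hölder functions in direction 2, with a constant that depends on the variables in
direction 1. -/
structure IsHolder {k : ℕ} (c : (Fin k → unitInterval) → ℝ) (γ : ℝ) (F : Inc k 1) : Prop where
  cont : ContInc F
  nonneg : ∀ s, 0 ≤ c s
  bound : ∀ s t, |F s t| ≤ c s
  holder : ∀ s t t', |F s ![t'] - F s ![t]| ≤ c s * |(t' : ℝ) - t| ^ γ

/-- The germ `F_{t₁} G_{t₁} (H_{t₂} - H_{t₁})` for `e = 0` and `F_{t₁} G_{t₂} (H_{t₂} - H_{t₁})`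
for `e = 1`. -/
def youngGerm {k : ℕ} (e : Fin 2) (F G H : Inc k 1) : Inc k 2 := fun s t =>
  F s ![t 0] * G s ![t e] * (H s ![t 1] - H s ![t 0])

section

variable {k : ℕ} {c₁ c₂ c₃ : (Fin k → unitInterval) → ℝ} {γ ρ β ν : ℝ} {F G H : Inc k 1}

theorem abs_mul_three_le {x y z a b c : ℝ} (hx : |x| ≤ a) (hy : |y| ≤ b) (hz : |z| ≤ c) :
    |x * y * z| ≤ a * b * c := by
  have ha := (abs_nonneg _).trans hx
  have hb := (abs_nonneg _).trans hy
  rw [abs_mul, abs_mul]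
  gcongr

theorem contInc_youngGerm (hF : ContInc F) (hG : ContInc G) (hH : ContInc H) (e : Fin 2) :
    ContInc (youngGerm e F G H) :=
  ((hF.comp (by fun_prop) (by fun_prop)).mul (hG.comp (by fun_prop) (by fun_prop))).mul
    ((hH.comp (by fun_prop) (by fun_prop)).sub (hH.comp (by fun_prop) (by fun_prop)))

theorem abs_youngGerm_le (hF : IsHolder c₁ γ F) (hG : IsHolder c₂ ρ G) (hH : IsHolder c₃ β H)
    (e : Fin 2) (s : Fin k → unitInterval) (t : Fin 2 → unitInterval) :
    |youngGerm e F G H s t| ≤ c₁ s * c₂ s * c₃ s * weight₂ β t :=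
  (abs_mul_three_le (hF.bound _ _) (hG.bound _ _) (hH.holder s (t 0) (t 1))).trans
    (le_of_eq (by unfold weight₂; ring))

/-- Discrete Leibniz rule: one term carries an increment of `F`, the other an increment of `G`, each
against an increment of `H`. For `e = 1` the increment of `G` lies on the right-hand interval, so
`(a, b)` is `(β, ρ)` instead of `(ρ, β)`. -/
theorem exists_delta₂_youngGerm (hρ : 0 < ρ) (hβ : 0 < β) (hF : IsHolder c₁ γ F)
    (hG : IsHolder c₂ ρ G) (hH : IsHolder c₃ β H) (e : Fin 2) :
    ∃ (Q₁ Q₂ : Inc k 3) (a b : ℝ), 0 < a ∧ 0 < b ∧ a + b = ρ + β ∧ ContInc Q₁ ∧ ContInc Q₂ ∧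
      (∀ s t, |Q₁ s t| ≤ c₁ s * c₂ s * c₃ s * weight₃ γ β t) ∧
      (∀ s t, |Q₂ s t| ≤ c₁ s * c₂ s * c₃ s * weight₃ a b t) ∧
      delta₂ (youngGerm e F G H) = Q₁ + Q₂ := by
  have cF : ∀ i : Fin 3, Continuous fun p : (Fin k → unitInterval) × (Fin 3 → unitInterval) =>
      F p.1 ![p.2 i] := fun i => hF.cont.comp (by fun_prop) (by fun_prop)
  have cG : ∀ i : Fin 3, Continuous fun p : (Fin k → unitInterval) × (Fin 3 → unitInterval) =>
      G p.1 ![p.2 i] := fun i => hG.cont.comp (by fun_prop) (by fun_prop)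
  have cH : ∀ i : Fin 3, Continuous fun p : (Fin k → unitInterval) × (Fin 3 → unitInterval) =>
      H p.1 ![p.2 i] := fun i => hH.cont.comp (by fun_prop) (by fun_prop)
  have hsymm : ∀ s t t', |F s ![t] - F s ![t']| ≤ c₁ s * |(t' : ℝ) - t| ^ γ := fun s t t' => by
    rw [abs_sub_comm]; exact hF.holder s t t'
  have hsymm' : ∀ s t t', |G s ![t] - G s ![t']| ≤ c₂ s * |(t' : ℝ) - t| ^ ρ := fun s t t' => by
    rw [abs_sub_comm]; exact hG.holder s t t'
  rcases (by fin_cases e <;> simp : e = 0 ∨ e = 1) with rfl | rfl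
  · refine ⟨fun s t => (F s ![t 0] - F s ![t 1]) * G s ![t 1] * (H s ![t 2] - H s ![t 1]),
      fun s t => F s ![t 0] * (G s ![t 0] - G s ![t 1]) * (H s ![t 2] - H s ![t 1]),
      ρ, β, hρ, hβ, rfl, (((cF 0).sub (cF 1)).mul (cG 1)).mul ((cH 2).sub (cH 1)),
      ((cF 0).mul ((cG 0).sub (cG 1))).mul ((cH 2).sub (cH 1)), fun s t => ?_, fun s t => ?_, ?_⟩
    · exact (abs_mul_three_le (hsymm _ _ _) (hG.bound _ _) (hH.holder _ _ _)).trans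
        (le_of_eq (by unfold weight₃; ring))
    · exact (abs_mul_three_le (hF.bound _ _) (hsymm' _ _ _) (hH.holder _ _ _)).trans
        (le_of_eq (by unfold weight₃; ring))
    · ext s t
      rw [delta₂_apply_two]
      simp only [youngGerm, Pi.add_apply, Matrix.cons_val_zero, Matrix.cons_val_one]
      ring
  · refine ⟨fun s t => (F s ![t 0] - F s ![t 1]) * G s ![t 2] * (H s ![t 2] - H s ![t 1]),
      fun s t => F s ![t 0] * (G s ![t 2] - G s ![t 1]) * (H s ![t 1] - H s ![t 0]),
      β, ρ, hβ, hρ, add_comm _ _, (((cF 0).sub (cF 1)).mul (cG 2)).mul ((cH 2).sub (cH 1)),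
      ((cF 0).mul ((cG 2).sub (cG 1))).mul ((cH 1).sub (cH 0)), fun s t => ?_, fun s t => ?_, ?_⟩
    · exact (abs_mul_three_le (hsymm _ _ _) (hG.bound _ _) (hH.holder _ _ _)).trans
        (le_of_eq (by unfold weight₃; ring))
    · exact (abs_mul_three_le (hF.bound _ _) (hG.holder _ _ _) (hH.holder _ _ _)).trans
        (le_of_eq (by unfold weight₃; ring))
    · ext s t
      rw [delta₂_apply_two]
      simp only [youngGerm, Pi.add_apply, Matrix.cons_val_zero, Matrix.cons_val_one]
      ring

theorem abs_delta₂_youngGerm_le (hγ : 0 < γ) (hρ : 0 < ρ) (hβ : 0 < β) (h₁ : ν ≤ γ + β)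
    (h₂ : ν ≤ ρ + β) (hF : IsHolder c₁ γ F) (hG : IsHolder c₂ ρ G) (hH : IsHolder c₃ β H)
    (e : Fin 2) (s : Fin k → unitInterval) (t : Fin 3 → unitInterval) :
    |delta₂ (youngGerm e F G H) s t| ≤ 2 * (c₁ s * c₂ s * c₃ s) * gap t ^ ν := by
  obtain ⟨Q₁, Q₂, a, b, ha, hb, hab, -, -, hQ₁, hQ₂, hQ⟩ :=
    exists_delta₂_youngGerm hρ hβ hF hG hH e
  have hc : 0 ≤ c₁ s * c₂ s * c₃ s :=
    mul_nonneg (mul_nonneg (hF.nonneg s) (hG.nonneg s)) (hH.nonneg s)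
  have e₁ := (hQ₁ s t).trans (mul_le_mul_of_nonneg_left (weight₃_le_gap hγ hβ h₁ t) hc)
  have e₂ := (hQ₂ s t).trans (mul_le_mul_of_nonneg_left (weight₃_le_gap ha hb (hab ▸ h₂) t) hc)
  rw [hQ]
  exact (abs_add_le _ _).trans ((add_le_add e₁ e₂).trans (le_of_eq (by ring)))

theorem sewable₂_youngGerm (hγ : 0 < γ) (hρ : 0 < ρ) (hβ : 0 < β) (hν : 1 < ν) (h₁ : ν ≤ γ + β)
    (h₂ : ν ≤ ρ + β) (hF : IsHolder c₁ γ F) (hG : IsHolder c₂ ρ G) (hH : IsHolder c₃ β H)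
    (e : Fin 2) {W : ℝ} (hW : ∀ s, c₁ s * c₂ s * c₃ s ≤ W) :
    Sewable₂ (fun s => 2 * (c₁ s * c₂ s * c₃ s)) ν (youngGerm e F G H) :=
  ⟨contInc_youngGerm hF.cont hG.cont hH.cont e, hν, fun s x => by simp [youngGerm],
    fun s => mul_nonneg zero_le_two
      (mul_nonneg (mul_nonneg (hF.nonneg s) (hG.nonneg s)) (hH.nonneg s)),
    ⟨2 * W, fun s => mul_le_mul_of_nonneg_left (hW s) zero_le_two⟩,
    abs_delta₂_youngGerm_le hγ hρ hβ h₁ h₂ hF hG hH e⟩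

theorem weight₂_mul_le (hρ : 0 < ρ) (hβ : 0 < β) (hν : 0 < ν) (h : ν ≤ ρ + β)
    (t : Fin 2 → unitInterval) : weight₂ ρ t * weight₂ β t ≤ weight₂ ν t := by
  refine le_trans (le_of_eq ?_) (weight₂_anti hν h t)
  exact (Real.rpow_add_of_nonneg (abs_nonneg _) hρ.le hβ.le).symm

/-- Evaluating `G` at either end of the interval gives the same Young integral. -/
theorem sew₂_youngGerm_one (hγ : 0 < γ) (hρ : 0 < ρ) (hβ : 0 < β) (hν : 1 < ν) (h₁ : ν ≤ γ + β)
    (h₂ : ν ≤ ρ + β) (hF : IsHolder c₁ γ F) (hG : IsHolder c₂ ρ G) (hH : IsHolder c₃ β H)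
    {W : ℝ} (hW : ∀ s, c₁ s * c₂ s * c₃ s ≤ W) :
    sew₂ (youngGerm 1 F G H) = sew₂ (youngGerm 0 F G H) := by
  have hs := sewable₂_youngGerm hγ hρ hβ hν h₁ h₂ hF hG hH 0 hW
  refine sew₂_eq_of_additive hν hs.delta₂_sew₂ (K := fun s => c₁ s * c₂ s * c₃ s +
    sewConst ν * (2 * (c₁ s * c₂ s * c₃ s))) fun s t => ?_
  have hc : 0 ≤ c₁ s * c₂ s * c₃ s :=
    mul_nonneg (mul_nonneg (hF.nonneg s) (hG.nonneg s)) (hH.nonneg s)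
  have e₁ : |youngGerm 1 F G H s t - youngGerm 0 F G H s t| ≤
      c₁ s * c₂ s * c₃ s * weight₂ ν t := by
    -- The difference is a product of two increments, of order `ρ + β ≥ ν > 1`.
    have : youngGerm 1 F G H s t - youngGerm 0 F G H s t =
        F s ![t 0] * (G s ![t 1] - G s ![t 0]) * (H s ![t 1] - H s ![t 0]) := by
      simp only [youngGerm]; ring
    rw [this]
    refine (abs_mul_three_le (hF.bound _ _) (hG.holder _ _ _) (hH.holder _ _ _)).trans ?_
    refine le_trans (le_of_eq ?_)
      (mul_le_mul_of_nonneg_left (weight₂_mul_le hρ hβ (by linarith) h₂ t) hc)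
    unfold weight₂
    ring
  rw [add_mul]
  exact (abs_sub_le _ _ _).trans (add_le_add e₁ (hs.abs_sub_sew₂_le s t))

end

theorem P23_delta₂_youngGerm {c₁ c₂ c₃ : (Fin 2 → unitInterval) → ℝ} {α γ ρ β ν C : ℝ}
    {F G H : Inc 2 1} (hα : 0 < α) (hγ : 0 < γ) (hρ : 0 < ρ) (hβ : 0 < β) (hν : 0 < ν)
    (h₁ : ν ≤ γ + β) (h₂ : ν ≤ ρ + β) (hF : IsHolder c₁ γ F) (hG : IsHolder c₂ ρ G)
    (hH : IsHolder c₃ β H) (e : Fin 2) (hC : 0 ≤ C)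
    (hc : ∀ s, c₁ s * c₂ s * c₃ s ≤ C * weight₂ α s) :
    P23 α ν (delta₂ (youngGerm e F G H)) := by
  obtain ⟨Q₁, Q₂, a, b, ha, hb, hab, hc₁, hc₂, hQ₁, hQ₂, hQ⟩ :=
    exists_delta₂_youngGerm hρ hβ hF hG hH e
  rw [hQ]
  exact P23_of_bounds hν hα hC hC hγ hβ ha hb h₁ (hab ▸ h₂) hc₁ hc₂
    (fun s t => (hQ₁ s t).trans (mul_le_mul_of_nonneg_right (hc s) (weight₃_nonneg _ _ _)))
    (fun s t => (hQ₂ s t).trans (mul_le_mul_of_nonneg_right (hc s) (weight₃_nonneg _ _ _)))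

theorem isGermPart_youngGerm {c₁ c₂ c₃ : (Fin 3 → unitInterval) → ℝ} {μ γ ρ β ν C a b : ℝ}
    {F G H : Inc 3 1} (hγ : 0 < γ) (hρ : 0 < ρ) (hβ : 0 < β)
    (h₁ : ν ≤ γ + β) (h₂ : ν ≤ ρ + β) (hF : IsHolder c₁ γ F) (hG : IsHolder c₂ ρ G)
    (hH : IsHolder c₃ β H) (e : Fin 2) (hC : 0 ≤ C) (ha : 0 < a) (hb : 0 < b) (hμ : μ ≤ a + b)
    (hc : ∀ s, c₁ s * c₂ s * c₃ s ≤ C * weight₃ a b s) :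
    IsGermPart μ β ν (youngGerm e F G H) := by
  refine ⟨a, b, 2 * C, ha, hb, by positivity, hμ, contInc_youngGerm hF.cont hG.cont hH.cont e,
    fun s t => (abs_youngGerm_le hF hG hH e s t).trans (mul_le_mul_of_nonneg_right ?_
      (weight₂_nonneg _ _)),
    fun s t => (abs_delta₂_youngGerm_le hγ hρ hβ h₁ h₂ hF hG hH e s t).trans
      (mul_le_mul_of_nonneg_right ?_ (Real.rpow_nonneg (gap_nonneg _) _))⟩
  · have := hc s
    have := mul_nonneg hC (weight₃_nonneg a b s)
    linarith
  · have := hc s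
    linarith

/-! ### The functions in `𝒫_{1,1}` -/

/-- The function `f` at the `i`-th variable. -/
def evalAt {k : ℕ} (f : Inc 1 1) (i : Fin k) : Inc k 1 := fun s t => f ![s i] t

/-- The increment of `f` between the `i`-th and the `j`-th variable. -/
def diffAt {k : ℕ} (f : Inc 1 1) (i j : Fin k) : Inc k 1 := fun s t => f ![s j] t - f ![s i] t

/-- One constant serves all positions. The sup bound on `f` comes from compactness; the product
bound on rectangular increments makes `diffAt f i j` Hölder in direction 2 with a constant that is
small in direction 1. -/
theorem P11.exists_isHolder {γ₁ γ₂ : ℝ} {f : Inc 1 1} (hf : P11 γ₁ γ₂ f) :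
    ∃ C, 0 ≤ C ∧ (∀ {k : ℕ} (i : Fin k), IsHolder (fun _ => C) γ₂ (evalAt f i)) ∧
      ∀ {k : ℕ} (i j : Fin k),
        IsHolder (fun s => C * |(s j : ℝ) - s i| ^ γ₁) γ₂ (diffAt f i j) := by
  obtain ⟨⟨hc, -, -⟩, ⟨C₁, h₁⟩, ⟨C₂, h₂⟩, -, C₃, h₃⟩ := hf
  obtain ⟨C₀, h₀⟩ : ∃ C, ∀ s t, |f s t| ≤ C := by
    obtain ⟨C, hC⟩ := isCompact_univ.exists_bound_of_continuousOn hc.continuousOn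
    exact ⟨C, fun s t => hC (s, t) (mem_univ _)⟩
  have hC₀ : C₀ ≤ |C₀| + |C₁| + |C₂| + |C₃| := by
    linarith [le_abs_self C₀, abs_nonneg C₁, abs_nonneg C₂, abs_nonneg C₃]
  have hC₁ : C₁ ≤ |C₀| + |C₁| + |C₂| + |C₃| := by
    linarith [le_abs_self C₁, abs_nonneg C₀, abs_nonneg C₂, abs_nonneg C₃]
  have hC₂ : C₂ ≤ |C₀| + |C₁| + |C₂| + |C₃| := by
    linarith [le_abs_self C₂, abs_nonneg C₁, abs_nonneg C₀, abs_nonneg C₃]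
  have hC₃ : C₃ ≤ |C₀| + |C₁| + |C₂| + |C₃| := by
    linarith [le_abs_self C₃, abs_nonneg C₁, abs_nonneg C₂, abs_nonneg C₀]
  have hC : 0 ≤ |C₀| + |C₁| + |C₂| + |C₃| := by positivity
  generalize |C₀| + |C₁| + |C₂| + |C₃| = C at *
  have hp : ∀ (x y : unitInterval) (γ : ℝ), 0 ≤ |(y : ℝ) - x| ^ γ := fun x y γ =>
    Real.rpow_nonneg (abs_nonneg _) _
  refine ⟨C, hC, fun {k} i => ⟨ContInc.comp hc (by fun_prop) (by fun_prop), fun _ => hC,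
    fun s t => (h₀ _ _).trans hC₀, fun s t t' => ?_⟩, fun {k} i j =>
    ⟨Continuous.sub (ContInc.comp hc (by fun_prop) (by fun_prop))
      (ContInc.comp hc (by fun_prop) (by fun_prop)), fun s => mul_nonneg hC (hp _ _ _),
      fun s t => ?_, fun s t t' => ?_⟩⟩
  · have := h₂ ![s i] ![t, t']
    rw [delta₂_apply_one] at this
    exact this.trans (mul_le_mul_of_nonneg_right hC₂ (hp _ _ _))
  · have := h₁ ![s i, s j] t
    rw [delta₁_apply_one] at this
    exact this.trans (mul_le_mul_of_nonneg_right hC₁ (hp _ _ _))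
  · have := h₃ ![s i, s j] ![t, t']
    rw [delta₁_apply_one, delta₂_apply_one, delta₂_apply_one] at this
    have e : diffAt f i j s ![t'] - diffAt f i j s ![t] =
        f ![s j] ![t'] - f ![s j] ![t] - (f ![s i] ![t'] - f ![s i] ![t]) := by
      simp only [diffAt]; ring
    rw [e]
    exact this.trans (mul_le_mul_of_nonneg_right (mul_le_mul_of_nonneg_right hC₃ (hp _ _ _))
      (hp _ _ _))

/-! ### The three germs as Young germs -/

theorem Inc.congr_one (f : Inc 1 1) {s s' t t' : Fin 1 → unitInterval} (hs : s 0 = s' 0)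
    (ht : t 0 = t' 0) : f s t = f s' t' := by
  rw [← vec_one s, ← vec_one s', ← vec_one t, ← vec_one t', hs, ht]

theorem germ₁_eq_youngGerm (f g h : Inc 1 1) :
    germ₁ f g h = youngGerm 0 (evalAt f 0) (diffAt g 0 1) (evalAt h 1) := by
  ext s t
  refine congrArg₂ (· * ·) (congrArg₂ (· * ·) (f.congr_one rfl rfl)
    ((delta₁_apply_one g _ _).trans ?_)) ((delta₂_apply_one h _ _).trans ?_)
  · exact congrArg₂ (· - ·) (g.congr_one rfl rfl) (g.congr_one rfl rfl)
  · exact congrArg₂ (· - ·) (h.congr_one rfl rfl) (h.congr_one rfl rfl)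

/-- Gluing after `δ₂h` places `δ₁g` at the second variable of direction 2, hence `e = 1`, while `h`
stays at the first variable of direction 1. -/
theorem germ₂_eq_youngGerm (f g h : Inc 1 1) :
    germ₂ f g h = youngGerm 1 (evalAt f 0) (diffAt g 0 1) (evalAt h 0) := by
  ext s t
  refine Eq.trans ?_ (mul_right_comm _ _ _)
  refine congrArg₂ (· * ·) (congrArg₂ (· * ·) (f.congr_one rfl rfl)
    ((delta₂_apply_one h _ _).trans ?_)) ((delta₁_apply_one g _ _).trans ?_)
  · exact congrArg₂ (· - ·) (h.congr_one rfl rfl) (h.congr_one rfl rfl)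
  · exact congrArg₂ (· - ·) (g.congr_one rfl rfl) (g.congr_one rfl rfl)

theorem germ₃_eq_youngGerm (f g h : Inc 1 1) :
    germ₃ f g h = youngGerm 0 (evalAt f 0) (diffAt g 0 1) (evalAt h 0) := by
  ext s t
  refine Eq.trans ?_ (mul_assoc _ _ _).symm
  refine congrArg₂ (· * ·) (f.congr_one rfl rfl) (congrArg₂ (· * ·)
    ((delta₁_apply_one g _ _).trans ?_) ((delta₂_apply_one h _ _).trans ?_))
  · exact congrArg₂ (· - ·) (g.congr_one rfl rfl) (g.congr_one rfl rfl)
  · exact congrArg₂ (· - ·) (h.congr_one rfl rfl) (h.congr_one rfl rfl)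

/-- Each summand pairs an increment of `g` with one of `f` or of `h` over the adjacent interval, and
is still a Young germ in direction 2. -/
theorem delta₁_youngGerm_right (f g h : Inc 1 1) :
    delta₁ (youngGerm 0 (evalAt f (0 : Fin 2)) (diffAt g 0 1) (evalAt h 1)) =
      youngGerm 0 (diffAt f 1 0) (diffAt g 1 2) (evalAt h 2) +
      youngGerm 0 (evalAt f 0) (diffAt g 0 1) (diffAt h 1 2) := by
  ext s t
  rw [delta₁_apply_two]
  simp only [youngGerm, evalAt, diffAt, Pi.add_apply, Matrix.cons_val_zero, Matrix.cons_val_one]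
  ring

theorem delta₁_youngGerm_left (e : Fin 2) (f g h : Inc 1 1) :
    delta₁ (youngGerm e (evalAt f (0 : Fin 2)) (diffAt g 0 1) (evalAt h 0)) =
      youngGerm e (diffAt f 1 0) (diffAt g 1 2) (evalAt h 1) +
      youngGerm e (evalAt f 0) (diffAt g 1 2) (diffAt h 1 0) := by
  ext s t
  rw [delta₁_apply_two]
  simp only [youngGerm, evalAt, diffAt, Pi.add_apply, Matrix.cons_val_zero, Matrix.cons_val_one]
  ring

theorem youngGerm_right_eq (f g h : Inc 1 1) :
    youngGerm 0 (evalAt f 0) (diffAt g 0 1) (evalAt h 1) =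
      youngGerm 0 (evalAt f 0) (diffAt g 0 1) (evalAt h (0 : Fin 2)) +
      youngGerm 0 (evalAt f 0) (diffAt g 0 1) (diffAt h 0 1) := by
  ext s t
  simp only [youngGerm, evalAt, diffAt, Pi.add_apply]
  ring

section

variable {γ₁ γ₂ ρ₁ ρ₂ β₁ β₂ μ ν : ℝ} {f g h : Inc 1 1}

/-- The germ with `h` evaluated at the right end of the interval in direction 1. -/
theorem isGerm_right (hγ₁ : 0 < γ₁) (hγ₂ : 0 < γ₂) (hρ₁ : 0 < ρ₁) (hρ₂ : 0 < ρ₂) (hβ₁ : 0 < β₁)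
    (hβ₂ : 0 < β₂) (hμ : 1 < μ) (hν : 1 < ν) (hβν : β₂ ≤ ν) (hμ₁ : μ ≤ γ₁ + ρ₁)
    (hμ₂ : μ ≤ β₁ + ρ₁) (hν₁ : ν ≤ γ₂ + β₂) (hν₂ : ν ≤ ρ₂ + β₂)
    (hf : P11 γ₁ γ₂ f) (hg : P11 ρ₁ ρ₂ g) (hh : P11 β₁ β₂ h) :
    IsGerm ρ₁ μ β₂ ν (youngGerm 0 (evalAt f 0) (diffAt g 0 1) (evalAt h 1)) := by
  obtain ⟨A, hA, fA, dA⟩ := hf.exists_isHolder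
  obtain ⟨B, hB, fB, dB⟩ := hg.exists_isHolder
  obtain ⟨D, hD, fD, dD⟩ := hh.exists_isHolder
  have hABD : 0 ≤ A * B * D := by positivity
  exact
  { α_pos := hρ₁
    β_pos := hβ₂
    one_lt_μ := hμ
    one_lt_ν := hν
    β_le := hβν
    cont := contInc_youngGerm (fA _).cont (dB _ _).cont (fD _).cont _
    bound := ⟨A * B * D, hABD, fun s t =>
      (abs_youngGerm_le (fA _) (dB _ _) (fD _) _ s t).trans
        (le_of_eq (by unfold weight₂; ring))⟩
    mem := P23_delta₂_youngGerm hρ₁ hγ₂ hρ₂ hβ₂ (by linarith) hν₁ hν₂ (fA _) (dB _ _) (fD _) _ hABD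
      fun s => le_of_eq (by unfold weight₂; ring)
    split := ⟨_, _,
      isGermPart_youngGerm hγ₂ hρ₂ hβ₂ hν₁ hν₂ (dA _ _) (dB _ _) (fD _) _ hABD hγ₁ hρ₁ hμ₁
        fun s => le_of_eq (by rw [abs_sub_comm (s 0 : ℝ)]; unfold weight₃; ring),
      isGermPart_youngGerm hγ₂ hρ₂ hβ₂ hν₁ hν₂ (fA _) (dB _ _) (dD _ _) _ hABD hρ₁ hβ₁
        (by linarith) fun s => le_of_eq (by unfold weight₃; ring),
      delta₁_youngGerm_right f g h⟩ }

/-- The germs with `h` evaluated at the left end of the interval in direction 1. -/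
theorem isGerm_left (hγ₁ : 0 < γ₁) (hγ₂ : 0 < γ₂) (hρ₁ : 0 < ρ₁) (hρ₂ : 0 < ρ₂) (hβ₁ : 0 < β₁)
    (hβ₂ : 0 < β₂) (hμ : 1 < μ) (hν : 1 < ν) (hβν : β₂ ≤ ν) (hμ₁ : μ ≤ γ₁ + ρ₁)
    (hμ₂ : μ ≤ β₁ + ρ₁) (hν₁ : ν ≤ γ₂ + β₂) (hν₂ : ν ≤ ρ₂ + β₂)
    (hf : P11 γ₁ γ₂ f) (hg : P11 ρ₁ ρ₂ g) (hh : P11 β₁ β₂ h) (e : Fin 2) :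
    IsGerm ρ₁ μ β₂ ν (youngGerm e (evalAt f 0) (diffAt g 0 1) (evalAt h 0)) := by
  obtain ⟨A, hA, fA, dA⟩ := hf.exists_isHolder
  obtain ⟨B, hB, fB, dB⟩ := hg.exists_isHolder
  obtain ⟨D, hD, fD, dD⟩ := hh.exists_isHolder
  have hABD : 0 ≤ A * B * D := by positivity
  exact
  { α_pos := hρ₁
    β_pos := hβ₂
    one_lt_μ := hμ
    one_lt_ν := hν
    β_le := hβν
    cont := contInc_youngGerm (fA _).cont (dB _ _).cont (fD _).cont _
    bound := ⟨A * B * D, hABD, fun s t =>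
      (abs_youngGerm_le (fA _) (dB _ _) (fD _) _ s t).trans
        (le_of_eq (by unfold weight₂; ring))⟩
    mem := P23_delta₂_youngGerm hρ₁ hγ₂ hρ₂ hβ₂ (by linarith) hν₁ hν₂ (fA _) (dB _ _) (fD _) _ hABD
      fun s => le_of_eq (by unfold weight₂; ring)
    split := ⟨_, _,
      isGermPart_youngGerm hγ₂ hρ₂ hβ₂ hν₁ hν₂ (dA _ _) (dB _ _) (fD _) _ hABD hγ₁ hρ₁ hμ₁
        fun s => le_of_eq (by rw [abs_sub_comm (s 0 : ℝ)]; unfold weight₃; ring),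
      isGermPart_youngGerm hγ₂ hρ₂ hβ₂ hν₁ hν₂ (fA _) (dB _ _) (dD _ _) _ hABD hβ₁ hρ₁
        hμ₂ fun s => le_of_eq (by rw [abs_sub_comm (s 0 : ℝ)]; unfold weight₃; ring),
      delta₁_youngGerm_left e f g h⟩ }

theorem sew₂_youngGerm_left (hγ₂ : 0 < γ₂) (hρ₁ : 0 < ρ₁) (hρ₂ : 0 < ρ₂)
    (hβ₂ : 0 < β₂) (hν : 1 < ν) (hν₁ : ν ≤ γ₂ + β₂) (hν₂ : ν ≤ ρ₂ + β₂)
    (hf : P11 γ₁ γ₂ f) (hg : P11 ρ₁ ρ₂ g) (hh : P11 β₁ β₂ h) :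
    sew₂ (youngGerm 1 (evalAt f 0) (diffAt g 0 1) (evalAt h (0 : Fin 2))) =
      sew₂ (youngGerm 0 (evalAt f 0) (diffAt g 0 1) (evalAt h 0)) := by
  obtain ⟨A, hA, fA, -⟩ := hf.exists_isHolder
  obtain ⟨B, hB, -, dB⟩ := hg.exists_isHolder
  obtain ⟨D, hD, fD, -⟩ := hh.exists_isHolder
  refine sew₂_youngGerm_one hγ₂ hρ₂ hβ₂ hν hν₁ hν₂ (fA _) (dB _ _) (fD _) (W := A * B * D)
    fun s => ?_
  have := weight₂_le_one hρ₁.le s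
  unfold weight₂ at this
  calc _ = A * B * D * |(s 1 : ℝ) - s 0| ^ ρ₁ := by ring
    _ ≤ _ := mul_le_of_le_one_right (by positivity) this

/-- The two germs differ by the one containing `diffAt g 0 1` and `diffAt h 0 1`, of order `ρ₁ + β₁
≥ μ > 1` in direction 1. Its `sew₂` keeps that order, so `sew₁` does not detect it. -/
theorem sew₁_sew₂_youngGerm_right (hγ₁ : 0 < γ₁) (hγ₂ : 0 < γ₂) (hρ₁ : 0 < ρ₁) (hρ₂ : 0 < ρ₂)
    (hβ₁ : 0 < β₁) (hβ₂ : 0 < β₂) (hμ : 1 < μ) (hν : 1 < ν) (hβν : β₂ ≤ ν) (hμ₁ : μ ≤ γ₁ + ρ₁)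
    (hμ₂ : μ ≤ β₁ + ρ₁) (hν₁ : ν ≤ γ₂ + β₂) (hν₂ : ν ≤ ρ₂ + β₂)
    (hf : P11 γ₁ γ₂ f) (hg : P11 ρ₁ ρ₂ g) (hh : P11 β₁ β₂ h) :
    sew₁ (sew₂ (youngGerm 0 (evalAt f 0) (diffAt g 0 1) (evalAt h 1))) =
      sew₁ (sew₂ (youngGerm 0 (evalAt f 0) (diffAt g 0 1) (evalAt h 0))) := by
  have hl := isGerm_left hγ₁ hγ₂ hρ₁ hρ₂ hβ₁ hβ₂ hμ hν hβν hμ₁ hμ₂ hν₁ hν₂ hf hg hh 0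
  obtain ⟨C, hC, hs₂⟩ := hl.exists_sewable₂
  obtain ⟨C', hC', hs₁⟩ := hl.exists_sewable₁
  obtain ⟨A, hA, fA, -⟩ := hf.exists_isHolder
  obtain ⟨B, hB, -, dB⟩ := hg.exists_isHolder
  obtain ⟨D, hD, -, dD⟩ := hh.exists_isHolder
  have hS := sewConst_pos hν
  have hw : ∀ s : Fin 2 → unitInterval, A * (B * |(s 1 : ℝ) - s 0| ^ ρ₁) *
      (D * |(s 1 : ℝ) - s 0| ^ β₁) ≤ A * B * D * weight₂ μ s := fun s => by
    refine le_trans (le_of_eq ?_) (mul_le_mul_of_nonneg_left (weight₂_mul_le hρ₁ hβ₁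
      (by linarith : 0 < μ) (by linarith) s) (by positivity : 0 ≤ A * B * D))
    unfold weight₂
    ring
  have hsD := sewable₂_youngGerm hγ₂ hρ₂ hβ₂ hν hν₁ hν₂ (fA 0) (dB 0 1) (dD (0 : Fin 2) 1) 0
    (W := A * B * D) fun s => (hw s).trans
      (mul_le_of_le_one_right (by positivity) (weight₂_le_one (by linarith) s))
  rw [youngGerm_right_eq, hs₂.sew₂_add hsD]
  refine sew₁_eq_of_additive hμ hs₁.delta₁_sew₁ (K := fun t => sewConst μ * (C' * weight₂ β₂ t) +
    (1 + sewConst ν) * (2 * (A * B * D))) fun s t => ?_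
  have e₁ := hs₁.abs_sub_sew₁_le s t
  have e₂ := abs_sew₂_le hβ₂ hβν hsD (fun s t =>
    (abs_youngGerm_le (fA 0) (dB 0 1) (dD (0 : Fin 2) 1) 0 s t).trans
      (mul_le_mul_of_nonneg_right (by
        have h0 := mul_nonneg (mul_nonneg ((fA 0).nonneg s) ((dB 0 1).nonneg s))
          ((dD (0 : Fin 2) 1).nonneg s)
        linarith) (weight₂_nonneg _ _))) s t
  rw [Pi.add_apply, Pi.add_apply, add_sub_right_comm, add_mul]
  refine (abs_add_le _ _).trans (add_le_add e₁ (e₂.trans ?_))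
  refine (mul_le_of_le_one_right ?_ (weight₂_le_one hβ₂.le t)).trans ?_
  · exact mul_nonneg (by positivity) (hsD.nonneg s)
  · have := hw s
    calc _ ≤ (1 + sewConst ν) * (2 * (A * B * D * weight₂ μ s)) := by gcongr
      _ = _ := by ring

end

end PlanarYoung

theorem mainTheorem9
    (γ₁ γ₂ ρ₁ ρ₂ β₁ β₂ : ℝ)
    (hγ₁ : 0 < γ₁) (hγ₂ : 0 < γ₂) (hρ₁ : 0 < ρ₁) (hρ₂ : 0 < ρ₂) (hβ₁ : 0 < β₁) (hβ₂ : 0 < β₂)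
    (hγρ₁ : 1 < γ₁ + ρ₁) (hγρ₂ : 1 < γ₂ + ρ₂)
    (hβγ₁ : 1 < β₁ + γ₁) (hβγ₂ : 1 < β₂ + γ₂)
    (hβρ₁ : 1 < β₁ + ρ₁) (hβρ₂ : 1 < β₂ + ρ₂)
    (f g h : Inc 1 1) (hf : P11 γ₁ γ₂ f) (hg : P11 ρ₁ ρ₂ g) (hh : P11 β₁ β₂ h) :
    -- the three sewing expressions are well defined
    IntegDefined (germ₁ f g h) ∧ IntegDefined (germ₂ f g h) ∧ IntegDefined (germ₃ f g h) ∧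
    -- they coincide
    mixedYoung f g h = integ (germ₂ f g h) ∧
    mixedYoung f g h = integ (germ₃ f g h) ∧
    -- Riemann sums
    ∀ s₁ s₂ t₁ t₂ : unitInterval, s₁ ≤ s₂ → t₁ ≤ t₂ →
      RiemannLimit s₁ s₂ t₁ t₂
        (fun s s' t t' => f ![s] ![t] * delta₁ g ![s, s'] ![t] * delta₂ h ![s'] ![t, t'])
        (mixedYoung f g h ![s₁, s₂] ![t₁, t₂]) ∧
      RiemannLimit s₁ s₂ t₁ t₂
        (fun s s' t t' => f ![s] ![t] * delta₁ g ![s, s'] ![t] * delta₂ h ![s] ![t, t'])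
        (mixedYoung f g h ![s₁, s₂] ![t₁, t₂]) ∧
      RiemannLimit s₁ s₂ t₁ t₂
        (fun s s' t t' => f ![s] ![t] * delta₂ h ![s] ![t, t'] * delta₁ g ![s, s'] ![t'])
        (mixedYoung f g h ![s₁, s₂] ![t₁, t₂]) := by
  -- `μ` is the worst order of the two parts of `δ₁` of the germs, `ν` that of the two terms of
  -- their `δ₂`.
  have hμ : 1 < min (γ₁ + ρ₁) (β₁ + ρ₁) := lt_min hγρ₁ hβρ₁
  have hν : 1 < min (γ₂ + β₂) (ρ₂ + β₂) := lt_min (by linarith) (by linarith)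
  have hβν : β₂ ≤ min (γ₂ + β₂) (ρ₂ + β₂) := le_min (by linarith) (by linarith)
  have hr := isGerm_right hγ₁ hγ₂ hρ₁ hρ₂ hβ₁ hβ₂ hμ hν hβν (min_le_left _ _) (min_le_right _ _)
    (min_le_left _ _) (min_le_right _ _) hf hg hh
  have hl := isGerm_left hγ₁ hγ₂ hρ₁ hρ₂ hβ₁ hβ₂ hμ hν hβν (min_le_left _ _) (min_le_right _ _)
    (min_le_left _ _) (min_le_right _ _) hf hg hh
  have e₂ := sew₂_youngGerm_left hγ₂ hρ₁ hρ₂ hβ₂ hν (min_le_left _ _) (min_le_right _ _) hf hg hh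
  have e₁ := sew₁_sew₂_youngGerm_right hγ₁ hγ₂ hρ₁ hρ₂ hβ₁ hβ₂ hμ hν hβν (min_le_left _ _)
    (min_le_right _ _) (min_le_left _ _) (min_le_right _ _) hf hg hh
  rw [← germ₁_eq_youngGerm] at hr e₁
  have hl₂ := hl 1
  have hl₃ := hl 0
  rw [← germ₂_eq_youngGerm] at hl₂ e₂
  rw [← germ₃_eq_youngGerm] at hl₃ e₁ e₂
  have e₁₃ : mixedYoung f g h = integ (germ₃ f g h) := by
    rw [mixedYoung, hr.integ_eq, hl₃.integ_eq, e₁]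
  have e₁₂ : mixedYoung f g h = integ (germ₂ f g h) := by
    rw [e₁₃, hl₂.integ_eq, hl₃.integ_eq, e₂]
  refine ⟨hr.integDefined, hl₂.integDefined, hl₃.integDefined, e₁₂, e₁₃,
    fun s₁ s₂ t₁ t₂ _ _ => ⟨?_, ?_, ?_⟩⟩
  · rw [mixedYoung]
    convert hr.riemannLimit s₁ s₂ t₁ t₂ using 1
    ext s s' t t'
    rw [germ₁_eq_youngGerm, delta₁_apply_one, delta₂_apply_one]
    rfl
  · rw [e₁₃]
    convert hl₃.riemannLimit s₁ s₂ t₁ t₂ using 1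
    ext s s' t t'
    rw [germ₃_eq_youngGerm, delta₁_apply_one, delta₂_apply_one]
    rfl
  · rw [e₁₂]
    convert hl₂.riemannLimit s₁ s₂ t₁ t₂ using 1
    ext s s' t t'
    rw [germ₂_eq_youngGerm, delta₁_apply_one, delta₂_apply_one, mul_right_comm]
    rfl
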